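/- Write $2^{[0,1]}$ for the collection of nonempty compact subsets of $[0,1]$. A continuum is a nonempty compact connected metrizable space. There is a function $F:[0,1]\to 2^{[0,1]}$ such that: - $F$ is upper semicontinuous (for every $x$ and every open $U\supseteq F(x)$ there is an open $V\ni x$ with $F(x')\subseteq U$ for all $x'\in V$); - $F$ is surjective ($\bigcup_{x\in[0,1]}F(x)=[0,1]$); - $F$ is light (for every $y\in[0,1]$ the set $\{x\in[0,1]:y\in F(x)\}$ has empty interior in $[0,1]$); - $F$ has the intermediate value property (whenever $x_1\ne x_2$, $y_1\in F(x_1)$, $y_2\in F(x_2)$, $y_1\neq y_2$ and $y$ is strictly between $y_1$ and $y_2$, there is $x$ strictly between $x_1$ and $x_2$ with $y\in F(x)$); - for every integer $n\ge 1$, $F$ has a periodic orbit of period $n$, i.e. a sequence $(x_i)_{i\ge0}$ in $[0,1]$ with $x_{i+1}\in F(x_i)$ for all $i$, such that $n$ is the least positive integer with $x_{n+i}=x_i$ for all $i\geq 0$; - the graph $\{(x,y)\in[0,1]^2:y\in F(x)\}$ has empty interior in $[0,1]^2$; and yet the inverse limit $$\varprojlim\{[0,1],F\}=\Big\{(x_0,x_1,\dots)\in\prod_{i\ge0}[0,1]:\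 x_{i}\in F(x_{i+1})\text{ for all }i\ge0\Big\},$$ with the subspace topology of the product, is a continuum that is - arcwise connected (any two distinct points are the endpoints of an arc, i.e. of a homeomorphic image of $[0,1]$, in it); - hereditarily decomposable (each of its subcontinua with more than one point is the union of two proper subcontinua); - tree-like (it is homeomorphic to the inverse limit of a sequence of trees with continuous single-valued bonding maps, where a tree is a continuum that is a union of finitely many arcs and in which any two distinct points are the endpoints of exactly one arc). -/

import Mathlib

open Set Topology TopologicalSpace unitInterval

/-! ### Set-valued functions on the unit interval

A function `[0,1] → 2^[0,1]`, where `2^[0,1]` is the collection of nonempty compact subsets of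
`[0,1]`, is a term of type `I → NonemptyCompacts I`. -/

/-- `F` is surjective as a set-valued function: every point lies in some value of `F`. -/
def SetValuedSurjective (F : I → NonemptyCompacts I) : Prop :=
  ∀ y : I, ∃ x : I, y ∈ F x

/-- `F` is light: for every `y`, the set of `x` with `y ∈ F x` has empty interior in `[0,1]`. -/
def IsLight (F : I → NonemptyCompacts I) : Prop :=
  ∀ y : I, interior {x : I | y ∈ F x} = ∅

/-- The intermediate value property of a set-valued function.
Here `uIoo a b` is the set of points strictly between `a` and `b`, in either order. -/
def HasIntermediateValueProperty (F : I → NonemptyCompacts I) : Prop :=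
  ∀ x₁ x₂ y₁ y₂ : I, x₁ ≠ x₂ → y₁ ≠ y₂ → y₁ ∈ F x₁ → y₂ ∈ F x₂ →
    ∀ y ∈ uIoo y₁ y₂, ∃ x ∈ uIoo x₁ x₂, y ∈ F x

/-- The graph of `F`, as a subset of the square. -/
def setValuedGraph (F : I → NonemptyCompacts I) : Set (I × I) :=
  {p | p.2 ∈ F p.1}

/-- An orbit of `F`: a sequence with `x (i + 1) ∈ F (x i)` for all `i`. -/
def IsOrbit (F : I → NonemptyCompacts I) (x : ℕ → I) : Prop :=
  ∀ i, x (i + 1) ∈ F (x i)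

/-- The sequence `x` is periodic with (least) period `n`. -/
def HasPeriod (x : ℕ → I) (n : ℕ) : Prop :=
  IsLeast {m : ℕ | 0 < m ∧ ∀ i, x (m + i) = x i} n

/-! ### Inverse limits -/

/-- The inverse limit of a sequence of spaces with set-valued bonding functions
`f i : X (i + 1) → 2^(X i)`, as a subset of the product. -/
def invLimit {X : ℕ → Type} (f : ∀ i, X (i + 1) → Set (X i)) : Set (∀ i, X i) :=
  {x | ∀ i, x i ∈ f i (x (i + 1))}

/-! ### Continua

Properties of subsets of a topological space, each referring to the subspace topology. -/

section Continua

variable {Z : Type*} [TopologicalSpace Z]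

/-- A continuum: a nonempty, compact, connected, metrizable (sub)space. -/
def IsContinuum (S : Set Z) : Prop :=
  MetrizableSpace S ∧ IsCompact S ∧ IsConnected S

/-- `A` is an arc with endpoints `a` and `b`: the image of an embedding of `[0,1]` that sends
`0` to `a` and `1` to `b`. -/
def IsArcBetween (A : Set Z) (a b : Z) : Prop :=
  ∃ γ : I → Z, IsEmbedding γ ∧ range γ = A ∧ γ 0 = a ∧ γ 1 = b

/-- Any two distinct points of `S` are the endpoints of an arc in `S`. -/
def IsArcwiseConnected (S : Set Z) : Prop :=
  ∀ a ∈ S, ∀ b ∈ S, a ≠ b → ∃ A ⊆ S, IsArcBetween A a b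

/-- Any two distinct points of `S` are the endpoints of exactly one arc in `S`. -/
def IsUniquelyArcwiseConnected (S : Set Z) : Prop :=
  ∀ a ∈ S, ∀ b ∈ S, a ≠ b → ∃! A : Set Z, A ⊆ S ∧ IsArcBetween A a b

/-- `S` is decomposable: it is the union of two proper subcontinua. -/
def IsDecomposable (S : Set Z) : Prop :=
  ∃ A B : Set Z, IsContinuum A ∧ IsContinuum B ∧ A ⊂ S ∧ B ⊂ S ∧ A ∪ B = S

/-- Every nondegenerate subcontinuum of `S` is decomposable. -/
def IsHereditarilyDecomposable (S : Set Z) : Prop :=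
  ∀ K ⊆ S, IsContinuum K → K.Nontrivial → IsDecomposable K

/-- A tree: a uniquely arcwise connected continuum that is the union of finitely many arcs. -/
def IsTopologicalTree (S : Set Z) : Prop :=
  IsContinuum S ∧
    (∃ 𝒜 : Set (Set Z), 𝒜.Finite ∧ (∀ A ∈ 𝒜, ∃ a b, IsArcBetween A a b) ∧ ⋃₀ 𝒜 = S) ∧
    IsUniquelyArcwiseConnected S

/-- `S` is tree-like: a continuum that is homeomorphic to the inverse limit of a sequence of trees
with continuous (single-valued) bonding maps. -/
def IsTreeLike (S : Set Z) : Prop :=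
  IsContinuum S ∧
    ∃ (T : ℕ → Type) (_ : ∀ i, TopologicalSpace (T i)) (g : ∀ i, T (i + 1) → T i),
      (∀ i, IsTopologicalTree (univ : Set (T i))) ∧ (∀ i, Continuous (g i)) ∧
      Nonempty (S ≃ₜ invLimit (fun i t => {g i t}))

end Continua

/-! The graph of `toothFunction` is the line y = x / 5 together with vertical teeth rising from it
over points of the Cantor set of base-5 expansions with digits 0, 2, 4. The tooth over a digit
sequence ends at the infimum of `cylinderHeight`, provided this is not below the line. A digit other
than the middle one at place n costs a factor (n+1)/(n+2). These factors tend to 1, so changing one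
late middle digit hardly shortens a tooth, and every tooth has teeth of nearly its height close by
on both sides: this gives the intermediate value property. Their product diverges to 0, so a tooth
of positive height has infinitely many middle digits available to change. The teeth stand over a
nowhere dense set, whence lightness, and two points whose values contain both of them give all
periods.

A point z of the inverse limit satisfies z (i+1) ≤ 5 * z i. Cutting z i at 5 ^ i * s yields another
point of the limit, which slides z down a path to the zero sequence as s decreases to 0. With z 0 as
height, the levels are totally disconnected because F is light. Such a system (`IsTruncationSystem`)
behaves like a rooted tree. A connected closed set cannot leave the part above a point of a level
without containing that point (`trunc_mem_of_isPreconnected`). This yields arcs, their uniqueness,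
and the fact that subcontinua are again truncation systems (`restrict`), so decomposability needs
proof only for the whole (`isDecomposable`).

For tree-likeness, `stageCollapse n` shrinks the 3 ^ n intervals of stage n of the Cantor set to
points. Collapsing term i by stage n + 1 - i leaves teeth over finite sets only and kills all late
terms, so the collapsed sequences form a tree. These trees have `toothLimit` as inverse limit
(`isTreeLike_toothLimit`). -/

/-! ### Truncation systems: arcs, subcontinua, decomposability, trees. -/

section TruncationSystems

variable {Z : Type*} [TopologicalSpace Z]

/-- In a compact totally disconnected set, a point can be separated from a closed set that misses it by a
partition of the set into two closed pieces. -/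
theorem exists_closed_partition [T2Space Z] {E B : Set Z} (hE : IsCompact E)
    (hd : IsTotallyDisconnected E) {p : Z} (hp : p ∈ E) (hB : IsClosed B) (hpB : p ∉ B) :
    ∃ E₁ E₂ : Set Z, IsClosed E₁ ∧ IsClosed E₂ ∧ E₁ ∪ E₂ = E ∧ Disjoint E₁ E₂ ∧ p ∈ E₁ ∧
      Disjoint E₁ B := by
  have : CompactSpace E := isCompact_iff_compactSpace.mp hE
  have : TotallyDisconnectedSpace E := totallyDisconnectedSpace_subtype_iff.mpr hd
  obtain ⟨V, hV, hpV, hVB⟩ := compact_exists_isClopen_in_isOpen (X := E)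
    (U := Subtype.val ⁻¹' Bᶜ) (hB.isOpen_compl.preimage continuous_subtype_val) (x := ⟨p, hp⟩) hpB
  refine ⟨Subtype.val '' V, Subtype.val '' Vᶜ, ?_, ?_, ?_, ?_, ⟨_, hpV, rfl⟩, ?_⟩
  · exact (hV.1.isCompact.image continuous_subtype_val).isClosed
  · exact (hV.compl.1.isCompact.image continuous_subtype_val).isClosed
  · rw [← image_union, union_compl_self, image_univ, Subtype.range_coe]
  · exact (disjoint_image_iff Subtype.val_injective).mpr disjoint_compl_right
  · rw [disjoint_left]
    rintro _ ⟨v, hv, rfl⟩ hb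
    exact hVB hv hb

/-- A compact set `S` with a height function `H` whose levels are totally disconnected, and truncations
`τ z s` that move a point `z` of `S` down to the height `s`, the point of least height `a` being
the truncation of every point. -/
structure IsTruncationSystem (S : Set Z) (H : Z → I) (τ : Z → I → Z) (a : I) : Prop where
  isCompact : IsCompact S
  continuous_height : Continuous H
  continuous_trunc : Continuous fun q : Z × I => τ q.1 q.2
  base_le : ∀ z ∈ S, a ≤ H z
  trunc_mem : ∀ z ∈ S, ∀ s, a ≤ s → τ z s ∈ S
  height_trunc : ∀ z ∈ S, ∀ s, a ≤ s → H (τ z s) = min (H z) s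
  trunc_height : ∀ z ∈ S, τ z (H z) = z
  trunc_trunc : ∀ z ∈ S, ∀ s, a ≤ s → ∀ t, a ≤ t → τ (τ z s) t = τ z (min s t)
  trunc_base : ∀ z ∈ S, ∀ w ∈ S, τ z a = τ w a
  level : ∀ s, IsTotallyDisconnected {z ∈ S | H z = s}

namespace IsTruncationSystem

variable {S : Set Z} {H : Z → I} {τ : Z → I → Z} {a : I}

theorem trunc_of_le (h : IsTruncationSystem S H τ a) {z : Z} (hz : z ∈ S) {s : I}
    (hs : H z ≤ s) : τ z s = z := by
  have ha := h.base_le z hz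
  have := h.trunc_trunc z hz (H z) ha s (ha.trans hs)
  rwa [h.trunc_height z hz, min_eq_left hs, h.trunc_height z hz] at this

theorem continuous_trunc_right (h : IsTruncationSystem S H τ a) (z : Z) : Continuous (τ z) :=
  h.continuous_trunc.comp (by fun_prop : Continuous fun s : I => (z, s))

theorem continuous_trunc_left (h : IsTruncationSystem S H τ a) (s : I) :
    Continuous fun z => τ z s :=
  h.continuous_trunc.comp (by fun_prop : Continuous fun z : Z => (z, s))

/-- The path `s ↦ τ z s` joins each point of `D` to the common truncation at `b`. -/
theorem isPreconnected_of_trunc_mem (h : IsTruncationSystem S H τ a) {D : Set Z} (hD : D ⊆ S)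
    {b : I} (hmem : ∀ z ∈ D, ∀ s, b ≤ s → τ z s ∈ D)
    (hbase : ∀ z ∈ D, ∀ w ∈ D, τ z b = τ w b) : IsPreconnected D := by
  rcases D.eq_empty_or_nonempty with rfl | ⟨z₀, hz₀⟩
  · exact isPreconnected_empty
  refine isPreconnected_of_forall (τ z₀ b) fun z hz => ⟨τ z '' Icc b 1, ?_, ?_, ?_, ?_⟩
  · rintro _ ⟨s, hs, rfl⟩
    exact hmem z hz s hs.1
  · exact ⟨b, ⟨le_rfl, le_one'⟩, hbase z hz z₀ hz₀⟩
  · exact ⟨1, ⟨le_one', le_rfl⟩, h.trunc_of_le (hD hz) le_one'⟩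
  · exact isPreconnected_Icc.image _ (h.continuous_trunc_right z).continuousOn

theorem isPreconnected (h : IsTruncationSystem S H τ a) : IsPreconnected S :=
  h.isPreconnected_of_trunc_mem subset_rfl h.trunc_mem h.trunc_base

theorem isCompact_level [T2Space Z] (h : IsTruncationSystem S H τ a) (s : I) :
    IsCompact {z ∈ S | H z = s} :=
  h.isCompact.inter_right (isClosed_eq h.continuous_height continuous_const)

/-- A closed connected set that contains a point above the truncation `τ x s` and a point
not above it contains `τ x s`. -/
theorem trunc_mem_of_isPreconnected [T2Space Z] (h : IsTruncationSystem S H τ a) {C : Set Z}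
    (hCS : C ⊆ S) (hC : IsClosed C) (hconn : IsPreconnected C) {x y : Z} (hx : x ∈ C)
    (hy : y ∈ C) {s : I} (hs : s ≤ H x) (has : a ≤ s) (hxy : s ≤ H y → τ y s ≠ τ x s) :
    τ x s ∈ C := by
  by_contra hp
  have hxS := hCS hx
  have hpE : τ x s ∈ {z ∈ S | H z = s} :=
    ⟨h.trunc_mem x hxS s has, by rw [h.height_trunc x hxS s has, min_eq_right hs]⟩
  -- `B` is what the piece of the level around `τ x s` must avoid: `C` itself and, if `y` is high
  -- enough, the point below `y`.
  obtain ⟨B, hB, hpB, hCB, hyB⟩ : ∃ B : Set Z, IsClosed B ∧ τ x s ∉ B ∧ C ⊆ B ∧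
      (s ≤ H y → τ y s ∈ B) := by
    by_cases hsy : s ≤ H y
    · refine ⟨C ∪ {τ y s}, hC.union isClosed_singleton, ?_, subset_union_left, fun _ => by simp⟩
      rintro (hc | hc)
      · exact hp hc
      · exact hxy hsy (mem_singleton_iff.mp hc).symm
    · exact ⟨C, hC, hp, subset_rfl, fun h' => absurd h' hsy⟩
  obtain ⟨E₁, E₂, hE₁, hE₂, hE, hdis, hpE₁, hdB⟩ :=
    exists_closed_partition (h.isCompact_level s) (h.level s) hpE hB hpB
  have hHc := h.continuous_height
  have hτc := h.continuous_trunc_left s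
  -- `C` is covered by the part above `E₁` and the rest. A common point either has height `s`, hence
  -- is its own truncation and lies in `E₁ ∩ C`, or has its truncation in `E₁ ∩ E₂`; both are empty.
  have key := isPreconnected_closed_iff.mp hconn
    ({z | s ≤ H z} ∩ {z | τ z s ∈ E₁}) ({z | H z ≤ s} ∪ {z | s ≤ H z} ∩ {z | τ z s ∈ E₂})
    ((isClosed_le continuous_const hHc).inter (hE₁.preimage hτc))
    ((isClosed_le hHc continuous_const).union
      ((isClosed_le continuous_const hHc).inter (hE₂.preimage hτc))) ?_ ⟨x, hx, hs, hpE₁⟩ ?_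
  · obtain ⟨z, hz, ⟨hz1, hz2⟩, hz3 | ⟨-, hz3⟩⟩ := key
    · have : τ z s = z := h.trunc_of_le (hCS hz) hz3
      rw [mem_ofPred_eq, this] at hz2
      exact disjoint_left.mp hdB hz2 (hCB hz)
    · exact disjoint_left.mp hdis hz2 hz3
  · intro z hz
    by_cases hzs : H z ≤ s
    · exact Or.inr (Or.inl hzs)
    · have hzs' := (not_le.mp hzs).le
      have : τ z s ∈ E₁ ∪ E₂ := by
        rw [hE]
        exact ⟨h.trunc_mem z (hCS hz) s has, by
          rw [h.height_trunc z (hCS hz) s has, min_eq_right hzs']⟩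
      rcases this with h1 | h1
      · exact Or.inl ⟨hzs', h1⟩
      · exact Or.inr (Or.inr ⟨hzs', h1⟩)
  · refine ⟨y, hy, ?_⟩
    by_cases hys : s ≤ H y
    · have : τ y s ∈ E₁ ∪ E₂ := by
        rw [hE]
        exact ⟨h.trunc_mem y (hCS hy) s has, by
          rw [h.height_trunc y (hCS hy) s has, min_eq_right hys]⟩
      rcases this with h1 | h1
      · exact absurd (hyB hys) (disjoint_left.mp hdB h1)
      · exact Or.inr ⟨hys, h1⟩
    · exact Or.inl (not_le.mp hys).le

/-- A subcontinuum is again a truncation system. -/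
theorem restrict [T2Space Z] (h : IsTruncationSystem S H τ a) {K : Set Z} (hKS : K ⊆ S)
    (hK : IsCompact K) (hconn : IsConnected K) : ∃ b, IsTruncationSystem K H τ b := by
  obtain ⟨e, he, hmin⟩ := hK.exists_isMinOn hconn.nonempty h.continuous_height.continuousOn
  have hae : a ≤ H e := h.base_le e (hKS he)
  have hmin' : ∀ z ∈ K, H e ≤ H z := fun z hz => hmin hz
  have hmem : ∀ z ∈ K, ∀ s, H e ≤ s → τ z s ∈ K := by
    -- Strictly above the minimal height, the lowest point `e` serves as the point not above `τ z
    -- s`; the height `H e` itself follows by taking closures.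
    have hlt : ∀ z ∈ K, ∀ s, H e < s → τ z s ∈ K := by
      intro z hz s hs
      rcases le_total (H z) s with hzs | hzs
      · rwa [h.trunc_of_le (hKS hz) hzs]
      · exact h.trunc_mem_of_isPreconnected hKS hK.isClosed hconn.isPreconnected hz he hzs
          (hae.trans hs.le) fun h' => absurd h' (not_le.mpr hs)
    intro z hz s hs
    rcases hs.lt_or_eq with hs | rfl
    · exact hlt z hz s hs
    rcases (hmin' z hz).lt_or_eq with hez | hez
    · have hsub : Ioc (H e) (H z) ⊆ τ z ⁻¹' K := fun s hs => hlt z hz s hs.1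
      have hcl := closure_minimal hsub (hK.isClosed.preimage (h.continuous_trunc_right z))
      rw [closure_Ioc hez.ne] at hcl
      exact hcl ⟨le_rfl, hez.le⟩
    · rwa [hez, h.trunc_height z (hKS hz)]
  refine ⟨H e, hK, h.continuous_height, h.continuous_trunc, hmin', hmem,
    fun z hz s hs => h.height_trunc z (hKS hz) s (hae.trans hs),
    fun z hz => h.trunc_height z (hKS hz),
    fun z hz s hs t ht => h.trunc_trunc z (hKS hz) s (hae.trans hs) t (hae.trans ht), ?_,
    fun s t ht hc => h.level s t (ht.trans fun z hz => ⟨hKS hz.1, hz.2⟩) hc⟩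
  intro z hz w hw
  -- The truncations at the minimal height form a connected subset of a totally disconnected level,
  -- hence a single point: the new root.
  have hsub : (fun z => τ z (H e)) '' K ⊆ {z ∈ S | H z = H e} := by
    rintro _ ⟨v, hv, rfl⟩
    exact ⟨h.trunc_mem v (hKS hv) _ hae, by
      rw [h.height_trunc v (hKS hv) _ hae, min_eq_right (hmin' v hv)]⟩
  exact h.level _ _ hsub
    (hconn.isPreconnected.image _ (h.continuous_trunc_left _).continuousOn)
    ⟨z, hz, rfl⟩ ⟨w, hw, rfl⟩

theorem isContinuum [MetrizableSpace Z] (h : IsTruncationSystem S H τ a) (hS : S.Nonempty) :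
    IsContinuum S :=
  ⟨inferInstance, h.isCompact, hS, h.isPreconnected⟩

/-- Cut at a height `c` strictly between the root and some point. If everything above `c` passes
through one point of the level, the parts below and above `c` decompose `S`. Otherwise split the
level into two closed pieces and attach to the lower part what lies above each piece. -/
theorem isDecomposable [MetrizableSpace Z] (h : IsTruncationSystem S H τ a)
    (hS : S.Nontrivial) : IsDecomposable S := by
  have hHc := h.continuous_height
  obtain ⟨z₀, hz₀, haz₀⟩ : ∃ z ∈ S, a < H z := by
    by_contra! hle
    obtain ⟨z, hz, w, hw, hzw⟩ := hS
    refine hzw ?_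
    rw [← h.trunc_of_le hz (hle z hz), ← h.trunc_of_le hw (hle w hw), h.trunc_base z hz w hw]
  obtain ⟨c, hac, hcz⟩ := exists_between haz₀
  have hroot : τ z₀ a ∈ S := h.trunc_mem z₀ hz₀ a le_rfl
  have hHroot : H (τ z₀ a) = a := by
    rw [h.height_trunc z₀ hz₀ a le_rfl, min_eq_right haz₀.le]
  have hlevel : ∀ z ∈ S, c ≤ H z → τ z c ∈ {z ∈ S | H z = c} := fun z hz hcz' =>
    ⟨h.trunc_mem z hz c hac.le, by rw [h.height_trunc z hz c hac.le, min_eq_right hcz']⟩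
  -- the part of `S` that lies below `c` or above a closed subset of the level of `c`
  have hcont : ∀ E : Set Z, IsClosed E →
      IsContinuum {z ∈ S | H z ≤ c ∨ c ≤ H z ∧ τ z c ∈ E} := by
    intro E hE
    refine ⟨inferInstance, ?_, ⟨τ z₀ a, hroot, Or.inl (hHroot.le.trans hac.le)⟩, ?_⟩
    · exact h.isCompact.inter_right ((isClosed_le hHc continuous_const).union
        ((isClosed_le continuous_const hHc).inter (hE.preimage (h.continuous_trunc_left c))))
    · refine h.isPreconnected_of_trunc_mem (fun z hz => hz.1) ?_
        fun z hz w hw => h.trunc_base z hz.1 w hw.1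
      rintro z ⟨hz, hzc⟩ s hs
      refine ⟨h.trunc_mem z hz s hs, ?_⟩
      rw [h.height_trunc z hz s hs, h.trunc_trunc z hz s hs c hac.le]
      rcases hzc with hzc | ⟨hzc, hzE⟩
      · exact Or.inl ((min_le_left _ _).trans hzc)
      · rcases le_total s c with hsc | hsc
        · exact Or.inl ((min_le_right _ _).trans hsc)
        · exact Or.inr ⟨le_min hzc hsc, by rwa [min_eq_right hsc]⟩
  by_cases hone : ∀ z ∈ S, c < H z → τ z c = τ z₀ c
  · refine ⟨{z ∈ S | H z ≤ c ∨ c ≤ H z ∧ τ z c ∈ (∅ : Set Z)},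
      {z ∈ S | c ≤ H z ∧ τ z c = τ z₀ c}, hcont ∅ isClosed_empty, ?_, ?_, ?_, ?_⟩
    · refine ⟨inferInstance, ?_, ⟨z₀, hz₀, hcz.le, rfl⟩, ?_⟩
      · exact h.isCompact.inter_right ((isClosed_le continuous_const hHc).inter
          (isClosed_eq (h.continuous_trunc_left c) continuous_const))
      · refine h.isPreconnected_of_trunc_mem (fun z hz => hz.1) ?_
          fun z hz w hw => hz.2.2.trans hw.2.2.symm
        rintro z ⟨hz, hcz', hzc⟩ s hs
        have hs' := hac.le.trans hs
        refine ⟨h.trunc_mem z hz s hs', ?_, ?_⟩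
        · rw [h.height_trunc z hz s hs']
          exact le_min hcz' hs
        · rwa [h.trunc_trunc z hz s hs' c hac.le, min_eq_right hs]
    · refine ssubset_of_subset_not_subset (fun z hz => hz.1) fun hsub => ?_
      rcases (hsub hz₀).2 with h' | h'
      · exact absurd hcz (not_lt.mpr h')
      · exact h'.2
    · refine ssubset_of_subset_not_subset (fun z hz => hz.1) fun hsub => ?_
      have := (hsub hroot).2.1
      rw [hHroot] at this
      exact absurd hac (not_lt.mpr this)
    · ext z
      refine ⟨fun hz => hz.elim (fun h' => h'.1) fun h' => h'.1, fun hz => ?_⟩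
      rcases le_or_gt (H z) c with hzc | hzc
      · exact Or.inl ⟨hz, Or.inl hzc⟩
      · exact Or.inr ⟨hz, hzc.le, hone z hz hzc⟩
  · push Not at hone
    obtain ⟨z₁, hz₁, hcz₁, hne⟩ := hone
    obtain ⟨E₁, E₂, hE₁, hE₂, hE, hdis, hp, hq⟩ := exists_closed_partition
      (h.isCompact_level c) (h.level c) (hlevel z₁ hz₁ hcz₁.le)
      (isClosed_singleton (x := τ z₀ c)) hne
    have hz₀E : τ z₀ c ∉ E₁ := fun h' => disjoint_left.mp hq h' rfl
    have hz₁E : τ z₁ c ∉ E₂ := fun h' => disjoint_left.mp hdis hp h'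
    refine ⟨_, _, hcont E₁ hE₁, hcont E₂ hE₂, ?_, ?_, ?_⟩
    · refine ssubset_of_subset_not_subset (fun z hz => hz.1) fun hsub => ?_
      rcases (hsub hz₀).2 with h' | h'
      · exact absurd hcz (not_lt.mpr h')
      · exact hz₀E h'.2
    · refine ssubset_of_subset_not_subset (fun z hz => hz.1) fun hsub => ?_
      rcases (hsub hz₁).2 with h' | h'
      · exact absurd hcz₁ (not_lt.mpr h')
      · exact hz₁E h'.2
    · ext z
      refine ⟨fun hz => hz.elim (fun h' => h'.1) fun h' => h'.1, fun hz => ?_⟩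
      rcases le_or_gt (H z) c with hzc | hzc
      · exact Or.inl ⟨hz, Or.inl hzc⟩
      · have := hlevel z hz hzc.le
        rw [← hE] at this
        exact this.imp (fun h' => ⟨hz, Or.inr ⟨hzc.le, h'⟩⟩) fun h' => ⟨hz, Or.inr ⟨hzc.le, h'⟩⟩

theorem isHereditarilyDecomposable [MetrizableSpace Z] (h : IsTruncationSystem S H τ a) :
    IsHereditarilyDecomposable S := by
  intro K hKS hK hnt
  obtain ⟨b, hb⟩ := h.restrict hKS hK.2.1 hK.2.2
  exact hb.isDecomposable hnt

/-- Two points are joined by an arc that lies in every closed connected set containing them. -/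
theorem exists_minimal_arc [T2Space Z] (h : IsTruncationSystem S H τ a) {x y : Z} (hx : x ∈ S)
    (hy : y ∈ S) (hxy : x ≠ y) :
    ∃ A ⊆ S, IsArcBetween A x y ∧
      ∀ C ⊆ S, IsClosed C → IsPreconnected C → x ∈ C → y ∈ C → A ⊆ C := by
  have hcx := h.continuous_trunc_right x
  have hcy := h.continuous_trunc_right y
  -- `m` is the height of the branch point: the arc descends from `x` to it and climbs to `y`.
  obtain ⟨m, ⟨⟨ham, hmx, hmy⟩, hm⟩, hmax⟩ : ∃ m, IsGreatest
      {s : I | (a ≤ s ∧ s ≤ H x ∧ s ≤ H y) ∧ τ x s = τ y s} m := by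
    have hcl : IsClosed {s : I | (a ≤ s ∧ s ≤ H x ∧ s ≤ H y) ∧ τ x s = τ y s} :=
      ((isClosed_le continuous_const continuous_id).inter
        ((isClosed_le continuous_id continuous_const).inter
          (isClosed_le continuous_id continuous_const))).inter (isClosed_eq hcx hcy)
    exact hcl.isCompact.exists_isGreatest
      ⟨a, ⟨le_rfl, h.base_le x hx, h.base_le y hy⟩, h.trunc_base x hx y hy⟩
  -- the arc, with the parameter `r` running from `m - H x` to `H y - m`
  let f : ℝ → Z := fun r => if r ≤ 0 then τ x (projIcc 0 1 zero_le_one (m - r))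
    else τ y (projIcc 0 1 zero_le_one (m + r))
  have hf : Continuous f := by
    refine Continuous.if_le (hcx.comp (continuous_projIcc.comp (by fun_prop)))
      (hcy.comp (continuous_projIcc.comp (by fun_prop))) continuous_id continuous_const ?_
    rintro r rfl
    simpa using hm
  have hfneg : ∀ s : I, m ≤ s → f (m - s) = τ x s := by
    intro s hs
    have hs' : (m : ℝ) - s ≤ 0 := sub_nonpos.mpr hs
    simp only [f, if_pos hs', sub_sub_cancel, projIcc_val]
  have hfpos : ∀ s : I, m ≤ s → f (s - m) = τ y s := by
    intro s hs
    rcases hs.lt_or_eq with hs | rfl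
    · have hs' : ¬ (s : ℝ) - m ≤ 0 := by
        rw [not_le, sub_pos]
        exact hs
      simp only [f, if_neg hs', add_sub_cancel, projIcc_val]
    · rw [hfneg _ le_rfl, hm]
  have hrep : ∀ r : ℝ, r ∈ Icc (m - H x : ℝ) (H y - m) →
      (∃ s : I, m ≤ s ∧ s ≤ H x ∧ r = m - s) ∨ ∃ s : I, m < s ∧ s ≤ H y ∧ r = s - m := by
    intro r hr
    have hm0 := m.2.1
    have h1 := (H x).2.2
    have h2 := (H y).2.2
    have hr1 := hr.1
    have hr2 := hr.2
    rcases le_or_gt r 0 with h0 | h0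
    · refine Or.inl ⟨⟨m - r, by linarith, by linarith⟩, ?_, ?_, by simp⟩
      · exact Subtype.coe_le_coe.mp (by simpa using h0)
      · exact Subtype.coe_le_coe.mp (by simp only; linarith)
    · refine Or.inr ⟨⟨m + r, by linarith, by linarith⟩, ?_, ?_, by simp⟩
      · exact Subtype.coe_lt_coe.mp (by simpa using h0)
      · exact Subtype.coe_le_coe.mp (by simp only; linarith)
  have hhx : ∀ s : I, m ≤ s → s ≤ H x → H (τ x s) = s := fun s hs hsx => by
    rw [h.height_trunc x hx s (ham.trans hs), min_eq_right hsx]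
  have hhy : ∀ s : I, m ≤ s → s ≤ H y → H (τ y s) = s := fun s hs hsy => by
    rw [h.height_trunc y hy s (ham.trans hs), min_eq_right hsy]
  have hdiff : ∀ s : I, m < s → s ≤ H x → s ≤ H y → τ x s ≠ τ y s := fun s hs hsx hsy he =>
    absurd (hmax ⟨⟨ham.trans hs.le, hsx, hsy⟩, he⟩) (not_le.mpr hs)
  have hinj : InjOn f (Icc (m - H x : ℝ) (H y - m)) := by
    intro r hr r' hr' hrr
    rcases hrep r hr with ⟨s, hs, hsx, rfl⟩ | ⟨s, hs, hsy, rfl⟩ <;>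
    rcases hrep r' hr' with ⟨s', hs', hsx', rfl⟩ | ⟨s', hs', hsy', rfl⟩
    · rw [hfneg s hs, hfneg s' hs'] at hrr
      rw [← hhx s hs hsx, hrr, hhx s' hs' hsx']
    · rw [hfneg s hs, hfpos s' hs'.le] at hrr
      have : s = s' := by rw [← hhx s hs hsx, hrr, hhy s' hs'.le hsy']
      subst this
      exact absurd hrr (hdiff s hs' hsx hsy')
    · rw [hfpos s hs.le, hfneg s' hs'] at hrr
      have : s' = s := by rw [← hhx s' hs' hsx', ← hrr, hhy s hs.le hsy]
      subst this
      exact absurd hrr.symm (hdiff s' hs hsx' hsy)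
    · rw [hfpos s hs.le, hfpos s' hs'.le] at hrr
      rw [← hhy s hs.le hsy, hrr, hhy s' hs'.le hsy']
  have hlt : (m - H x : ℝ) < H y - m := by
    have hmx' : (m : ℝ) ≤ H x := hmx
    have hmy' : (m : ℝ) ≤ H y := hmy
    refine lt_of_le_of_ne (by linarith) fun he => hxy ?_
    have e1 : H x = m := Subtype.ext (by linarith)
    have e2 : H y = m := Subtype.ext (by linarith)
    rw [← h.trunc_height x hx, ← h.trunc_height y hy, e1, e2, hm]
  have hfx : f (m - H x) = x := by rw [hfneg _ hmx, h.trunc_height x hx]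
  have hfy : f (H y - m) = y := by rw [hfpos _ hmy, h.trunc_height y hy]
  have himage : f '' Icc (m - H x : ℝ) (H y - m) ⊆ S := by
    rintro _ ⟨r, hr, rfl⟩
    rcases hrep r hr with ⟨s, hs, hsx, rfl⟩ | ⟨s, hs, hsy, rfl⟩
    · rw [hfneg s hs]
      exact h.trunc_mem x hx s (ham.trans hs)
    · rw [hfpos s hs.le]
      exact h.trunc_mem y hy s (ham.trans hs.le)
  refine ⟨f '' Icc (m - H x : ℝ) (H y - m), himage, ?_, ?_⟩
  · let e := (iccHomeoI (m - H x : ℝ) (H y - m) hlt).symm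
    refine ⟨fun t => f (e t), ?_, ?_, ?_, ?_⟩
    · refine (Continuous.isClosedEmbedding (hf.comp (continuous_subtype_val.comp e.continuous))
        ?_).isEmbedding
      exact hinj.injective.comp e.injective
    · rw [show (fun t => f (e t)) = (fun r : Icc (m - H x : ℝ) (H y - m) => f r) ∘ e from rfl,
        e.surjective.range_comp]
      ext z
      simp
    · have : ((e 0 : Icc (m - H x : ℝ) (H y - m)) : ℝ) = m - H x := by simp [e]
      simp only [this, hfx]
    · have : ((e 1 : Icc (m - H x : ℝ) (H y - m)) : ℝ) = H y - m := by simp [e]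
      simp only [this, hfy]
  · intro C hCS hC hconn hxC hyC
    -- Above `m` the two branches are disjoint, so the other endpoint is not above `τ x s`. The
    -- branch point itself is reached by closure.
    have hIoc : ∀ s : I, m < s → s ≤ H x → τ x s ∈ C := fun s hs hsx =>
      h.trunc_mem_of_isPreconnected hCS hC hconn hxC hyC hsx (ham.trans hs.le)
        fun hsy => (hdiff s hs hsx hsy).symm
    rintro _ ⟨r, hr, rfl⟩
    rcases hrep r hr with ⟨s, hs, hsx, rfl⟩ | ⟨s, hs, hsy, rfl⟩
    · rw [hfneg s hs]
      rcases hs.lt_or_eq with hs | rfl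
      · exact hIoc s hs hsx
      rcases hmx.lt_or_eq with hlt' | he
      · have hsub : Ioc m (H x) ⊆ τ x ⁻¹' C := fun s hs => hIoc s hs.1 hs.2
        have hcl := closure_minimal hsub (hC.preimage hcx)
        rw [closure_Ioc hlt'.ne] at hcl
        exact hcl ⟨le_rfl, hlt'.le⟩
      · rwa [he, h.trunc_height x hx]
    · rw [hfpos s hs.le]
      exact h.trunc_mem_of_isPreconnected hCS hC hconn hyC hxC hsy (ham.trans hs.le)
        fun hsx => hdiff s hs hsx hsy

theorem isArcwiseConnected [T2Space Z] (h : IsTruncationSystem S H τ a) :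
    IsArcwiseConnected S := fun _ hx _ hy hxy =>
  let ⟨A, hA, hA', _⟩ := h.exists_minimal_arc hx hy hxy
  ⟨A, hA, hA'⟩

/-- A second arc is closed and connected, so it contains the minimal one. The preimage of the
minimal arc in the parameter interval is then connected and contains both ends, so the two arcs
agree. -/
theorem isUniquelyArcwiseConnected [T2Space Z] (h : IsTruncationSystem S H τ a) :
    IsUniquelyArcwiseConnected S := by
  intro x hx y hy hxy
  obtain ⟨A, hA, hA', hmin⟩ := h.exists_minimal_arc hx hy hxy
  refine ⟨A, ⟨hA, hA'⟩, ?_⟩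
  rintro B ⟨hB, γ, hγ, rfl, rfl, rfl⟩
  have hAB : A ⊆ range γ := hmin _ hB (isCompact_range hγ.continuous).isClosed
    (isPreconnected_range hγ.continuous) ⟨0, rfl⟩ ⟨1, rfl⟩
  obtain ⟨δ, hδ, rfl, hδ0, hδ1⟩ := hA'
  refine subset_antisymm ?_ hAB
  have hpre : IsPreconnected (γ ⁻¹' range δ) := by
    rw [← hγ.isInducing.isPreconnected_image, image_preimage_eq_of_subset hAB]
    exact isPreconnected_range hδ.continuous
  have h01 : Icc (0 : I) 1 ⊆ γ ⁻¹' range δ :=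
    hpre.ordConnected.out ⟨0, hδ0⟩ ⟨1, hδ1⟩
  rintro _ ⟨t, rfl⟩
  exact h01 ⟨nonneg', le_one'⟩

/-- A truncation system that is a finite union of closed sets in which points are determined by
their heights as truncations of one another is a tree. -/
theorem isTopologicalTree [MetrizableSpace Z] (h : IsTruncationSystem S H τ a)
    (hS : S.Nontrivial) {𝒞 : Set (Set Z)} (hfin : 𝒞.Finite) (hcover : S ⊆ ⋃₀ 𝒞)
    (hclosed : ∀ C ∈ 𝒞, IsClosed C)
    (hchain : ∀ C ∈ 𝒞, ∀ z ∈ S ∩ C, ∀ w ∈ S ∩ C, H z ≤ H w → z = τ w (H z)) :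
    IsTopologicalTree S := by
  refine ⟨h.isContinuum hS.nonempty, ?_, h.isUniquelyArcwiseConnected⟩
  obtain ⟨z₀, hz₀⟩ := hS.nonempty
  set o := τ z₀ a with ho
  have hoS : o ∈ S := h.trunc_mem z₀ hz₀ a le_rfl
  have hHo : H o = a := by rw [ho, h.height_trunc z₀ hz₀ a le_rfl, min_eq_right (h.base_le _ hz₀)]
  have hob : ∀ z ∈ S, τ z a = o := fun z hz => h.trunc_base z hz z₀ hz₀
  -- The arc from the root to the highest point of a member of `𝒞` will contain that whole member.
  -- If this point is the root, any arc issuing from the root does.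
  have harc : ∀ x ∈ S, x ≠ o → ∃ A ⊆ S, IsArcBetween A o x ∧ ∀ s, a ≤ s → τ x s ∈ A := by
    intro x hx hxo
    obtain ⟨A, hA, hAB, -⟩ := h.exists_minimal_arc hoS hx hxo.symm
    refine ⟨A, hA, hAB, fun s hs => ?_⟩
    obtain ⟨γ, hγ, rfl, h0, h1⟩ := hAB
    rcases le_total (H x) s with hxs | hxs
    · rw [h.trunc_of_le hx hxs]
      exact ⟨1, h1⟩
    rcases hs.lt_or_eq with hs' | rfl
    · refine h.trunc_mem_of_isPreconnected (y := o) hA (isCompact_range hγ.continuous).isClosed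
        (isPreconnected_range hγ.continuous) ⟨1, h1⟩ ⟨0, h0⟩ hxs hs fun h' => ?_
      rw [hHo] at h'
      exact absurd h' (not_le.mpr hs')
    · rw [hob x hx]
      exact ⟨0, h0⟩
  have hleaf : ∀ C ∈ 𝒞, ∃ A ⊆ S, (∃ b c, IsArcBetween A b c) ∧ S ∩ C ⊆ A := by
    intro C hC
    obtain ⟨x₁, hx₁, hx₁o⟩ := hS.exists_ne o
    rcases (S ∩ C).eq_empty_or_nonempty with hemp | hne
    · obtain ⟨A, hA, hAB, -⟩ := harc x₁ hx₁ hx₁o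
      exact ⟨A, hA, ⟨_, _, hAB⟩, by simp [hemp]⟩
    obtain ⟨l, hl, hmax⟩ := (h.isCompact.inter_right (hclosed C hC)).exists_isMaxOn hne
      h.continuous_height.continuousOn
    have hall : ∀ z ∈ S ∩ C, z = τ l (H z) := fun z hz => hchain C hC z hz l hl (hmax hz)
    by_cases hlo : l = o
    · obtain ⟨A, hA, hAB, hAm⟩ := harc x₁ hx₁ hx₁o
      refine ⟨A, hA, ⟨_, _, hAB⟩, fun z hz => ?_⟩
      have hza : H z = a := le_antisymm
        ((show H z ≤ H l from hmax hz).trans (by rw [hlo, hHo])) (h.base_le z hz.1)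
      rw [hall z hz, hza, hob l hl.1, ← hob x₁ hx₁]
      exact hAm a le_rfl
    · obtain ⟨A, hA, hAB, hAm⟩ := harc l hl.1 hlo
      refine ⟨A, hA, ⟨_, _, hAB⟩, fun z hz => ?_⟩
      rw [hall z hz]
      exact hAm _ (h.base_le z hz.1)
  choose! A hAS hAarc hCA using hleaf
  refine ⟨A '' 𝒞, hfin.image A, ?_, subset_antisymm ?_ ?_⟩
  · rintro _ ⟨C, hC, rfl⟩
    exact hAarc C hC
  · rintro z ⟨_, ⟨C, hC, rfl⟩, hz⟩
    exact hAS C hC hz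
  · intro z hz
    obtain ⟨C, hC, hzC⟩ := hcover hz
    exact ⟨A C, ⟨C, hC, rfl⟩, hCA C hC ⟨hz, hzC⟩⟩

/-- A truncation system of least height `0`, regarded as a space of its own. -/
theorem subtype (h : IsTruncationSystem S H τ 0) :
    IsTruncationSystem (univ : Set S) (fun z => H z)
      (fun z s => ⟨τ z s, h.trunc_mem z z.2 s nonneg'⟩) 0 where
  isCompact := isCompact_iff_isCompact_univ.mp h.isCompact
  continuous_height := h.continuous_height.comp continuous_subtype_val
  continuous_trunc := by
    refine Continuous.subtype_mk (h.continuous_trunc.comp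
      (by fun_prop : Continuous fun q : S × I => ((q.1 : Z), q.2))) _
  base_le _ _ := nonneg'
  trunc_mem _ _ _ _ := mem_univ _
  height_trunc z _ := h.height_trunc z z.2
  trunc_height z _ := Subtype.ext (h.trunc_height z z.2)
  trunc_trunc z _ s hs t ht := Subtype.ext (h.trunc_trunc z z.2 s hs t ht)
  trunc_base z _ w _ := Subtype.ext (h.trunc_base z z.2 w w.2)
  level s := by
    refine isTotallyDisconnected_of_image (f := Subtype.val) continuous_subtype_val.continuousOn
      Subtype.val_injective fun t ht hc => h.level s t (ht.trans ?_) hc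
    rintro _ ⟨z, hz, rfl⟩
    exact ⟨z.2, hz.2⟩

end IsTruncationSystem

end TruncationSystems

/-! ### Inverse limits of toothed relations as truncation systems, and a criterion for trees. -/

section TruncatedSequences

/-- The sequence `z` truncated at the height `s`. -/
noncomputable def seqTrunc (z : ℕ → I) (s : I) : ℕ → I := fun i =>
  ⟨min (z i : ℝ) (5 ^ i * s), le_min (z i).2.1 (by have := s.2.1; positivity),
    (min_le_left _ _).trans (z i).2.2⟩

@[simp]
theorem coe_seqTrunc (z : ℕ → I) (s : I) (i : ℕ) :
    (seqTrunc z s i : ℝ) = min (z i : ℝ) (5 ^ i * s) := rfl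

/-- The sequences whose consecutive terms are related by a given sequence of relations. -/
def relSequences (R : ℕ → I → I → Prop) : Set (ℕ → I) :=
  {z | ∀ i, R i (z i) (z (i + 1))}

/-- Conditions on a sequence of closed relations under which the related sequences form a truncation
system: the points related to `x` fill a segment that starts at `x / 5`. -/
structure IsToothed (R : ℕ → I → I → Prop) : Prop where
  isClosed : ∀ i, IsClosed {q : I × I | R i q.1 q.2}
  le_of_rel : ∀ i y x, R i y x → (x : ℝ) ≤ 5 * y
  segment : ∀ i y x, R i y x → ∀ y' : I, (x : ℝ) ≤ 5 * y' → y' ≤ y → R i y' x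
  base : ∀ i y x, R i y x → ∀ x' y' : I, x' ≤ x → (x' : ℝ) = 5 * y' → R i y' x'
  light : ∀ i y, interior {x | R i y x} = ∅

theorem subsingleton_of_isPreconnected_of_interior_eq_empty {s : Set I} (hs : IsPreconnected s)
    (h : interior s = ∅) : s.Subsingleton := by
  have key : ∀ x ∈ s, ∀ y ∈ s, ¬ x < y := by
    intro x hx y hy hxy
    have hsub : Ioo x y ⊆ interior s :=
      interior_maximal (Ioo_subset_Icc_self.trans (hs.ordConnected.out hx hy)) isOpen_Ioo
    obtain ⟨c, hc⟩ := exists_between hxy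
    rw [h] at hsub
    exact hsub hc
  intro x hx y hy
  exact le_antisymm (not_lt.mp (key y hy x hx)) (not_lt.mp (key x hx y hy))

namespace IsToothed

variable {R : ℕ → I → I → Prop}

theorem le_pow_mul (h : IsToothed R) {z : ℕ → I} (hz : z ∈ relSequences R) (i j : ℕ) :
    (z (i + j) : ℝ) ≤ 5 ^ j * z i := by
  induction j with
  | zero => simp
  | succ j ih =>
    have := h.le_of_rel _ _ _ (hz (i + j))
    rw [← add_assoc, pow_succ]
    linarith

/-- If the cut leaves term `i + 1` unchanged, then term `i` stays on the same tooth and `segment`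
applies. Otherwise both terms are cut to consecutive points of the base line. -/
theorem seqTrunc_mem (h : IsToothed R) {z : ℕ → I} (hz : z ∈ relSequences R) (s : I) :
    seqTrunc z s ∈ relSequences R := by
  intro i
  have hs := s.2.1
  have hi := h.le_of_rel _ _ _ (hz i)
  have hle : seqTrunc z s i ≤ z i := Subtype.coe_le_coe.mp (min_le_left _ _)
  have hle' : seqTrunc z s (i + 1) ≤ z (i + 1) := Subtype.coe_le_coe.mp (min_le_left _ _)
  rcases le_total (z (i + 1) : ℝ) (5 ^ (i + 1) * s) with h1 | h1
  · have : seqTrunc z s (i + 1) = z (i + 1) := Subtype.ext (min_eq_left h1)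
    rw [this]
    refine h.segment i _ _ (hz i) _ ?_ hle
    rw [pow_succ] at h1
    rw [coe_seqTrunc, mul_min_of_nonneg _ _ (by norm_num)]
    exact le_min hi (by linarith)
  · refine h.base i _ _ (hz i) _ _ hle' ?_
    rw [pow_succ] at h1
    rw [coe_seqTrunc, coe_seqTrunc, min_eq_right (by rw [pow_succ]; linarith), min_eq_right (by linarith)]
    ring

theorem isClosed_relSequences (h : IsToothed R) : IsClosed (relSequences R) := by
  have : relSequences R = ⋂ i, (fun z : ℕ → I => (z i, z (i + 1))) ⁻¹' {q : I × I | R i q.1 q.2} := by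
    ext z
    simp [relSequences]
  rw [this]
  exact isClosed_iInter fun i => (h.isClosed i).preimage (by fun_prop)

theorem isTruncationSystem (h : IsToothed R) :
    IsTruncationSystem (relSequences R) (fun z => z 0) seqTrunc 0 where
  isCompact := h.isClosed_relSequences.isCompact
  continuous_height := continuous_apply 0
  continuous_trunc := by
    refine continuous_pi fun i => Continuous.subtype_mk ?_ _
    fun_prop
  base_le _ _ := nonneg'
  trunc_mem _ hz s _ := h.seqTrunc_mem hz s
  height_trunc z _ s _ := by
    have : seqTrunc z s 0 = min (z 0) s := by
      rcases le_total (z 0) s with hzs | hzs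
      · rw [min_eq_left hzs]
        exact Subtype.ext (by simpa using hzs)
      · rw [min_eq_right hzs]
        exact Subtype.ext (by simpa using hzs)
    exact this
  trunc_height z hz := by
    funext i
    apply Subtype.ext
    rw [coe_seqTrunc, min_eq_left]
    simpa using h.le_pow_mul hz 0 i
  trunc_trunc z _ s _ t _ := by
    funext i
    apply Subtype.ext
    rw [coe_seqTrunc, coe_seqTrunc, coe_seqTrunc, min_assoc, ← mul_min_of_nonneg _ _ (by positivity)]
    rfl
  trunc_base z _ w _ := by
    funext i
    apply Subtype.ext
    simp [(z i).2.1, (w i).2.1]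
  level s C hC hconn := by
    -- On a connected part of a level, term 0 is fixed. Once term `i` is fixed, term `i + 1` ranges
    -- over an interval inside a set with empty interior.
    have key : ∀ i, ((fun z : ℕ → I => z i) '' C).Subsingleton := by
      intro i
      induction i with
      | zero =>
        rintro _ ⟨z, hz, rfl⟩ _ ⟨w, hw, rfl⟩
        exact (hC hz).2.trans (hC hw).2.symm
      | succ i ih =>
        rcases C.eq_empty_or_nonempty with rfl | ⟨z₀, hz₀⟩
        · simp
        refine subsingleton_of_isPreconnected_of_interior_eq_empty
          (hconn.image _ (continuous_apply _).continuousOn)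
          (subset_eq_empty (interior_mono ?_) (h.light i (z₀ i)))
        rintro _ ⟨z, hz, rfl⟩
        have := (hC hz).1 i
        have he : z i = z₀ i := ih ⟨z, hz, rfl⟩ ⟨z₀, hz₀, rfl⟩
        rwa [he] at this
    intro z hz w hw
    funext i
    exact key i ⟨z, hz, rfl⟩ ⟨w, hw, rfl⟩

end IsToothed

/-- The sequences that follow the base line up to the index `i`, and agree
with `w` after it. -/
def baseSegment (w : ℕ → I) (i : ℕ) : Set (ℕ → I) :=
  {z | (∀ j ≤ i, (z j : ℝ) = 5 ^ j * z 0) ∧ ∀ j, i < j → z j = w j}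

theorem isClosed_baseSegment (w : ℕ → I) (i : ℕ) : IsClosed (baseSegment w i) := by
  simp only [baseSegment, ofPred_and, ofPred_forall]
  refine IsClosed.inter ?_ ?_
  · exact isClosed_iInter fun j => isClosed_iInter fun _ => isClosed_eq (by fun_prop) (by fun_prop)
  · exact isClosed_iInter fun j => isClosed_iInter fun _ => isClosed_eq (by fun_prop) (by fun_prop)

namespace IsToothed

variable {R : ℕ → I → I → Prop}

/-- If the teeth of the relations stand over finite sets, and the relations are trivial from some index on,
then the related sequences form a tree. -/
theorem isTopologicalTree (h : IsToothed R) (hnt : (relSequences R).Nontrivial) {n : ℕ}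
    (hn : ∀ z ∈ relSequences R, ∀ i, n ≤ i → z i = 0) {V : ℕ → Set I} (hV : ∀ i, (V i).Finite)
    (hRV : ∀ i y x, R i y x → (x : ℝ) = 5 * y ∨ x ∈ V i) :
    IsTopologicalTree (univ : Set (relSequences R)) := by
  -- the finitely many tails of the related sequences after a prescribed term
  have htail : ∀ i v, {w : ℕ → I | ∃ z ∈ relSequences R, z (i + 1) = v ∧
      w = fun j => if j ≤ i then 0 else z j}.Finite := by
    have hbig : ∀ i, n ≤ i → ∀ v, {w : ℕ → I | ∃ z ∈ relSequences R, z (i + 1) = v ∧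
      w = fun j => if j ≤ i then 0 else z j}.Finite := by
      intro i hi v
      refine (finite_singleton (fun _ => 0)).subset ?_
      rintro _ ⟨z, hz, -, rfl⟩
      refine funext fun j => ?_
      by_cases hj : j ≤ i
      · simp [hj]
      · simp [hj, hn z hz j (by omega)]
    -- After the value `v`, the next term is `5 * v` or one of the finitely many vertices. Zeroing
    -- the terms up to `i` merely encodes a tail as a full sequence.
    have hstep : ∀ i, (∀ v, {w : ℕ → I | ∃ z ∈ relSequences R, z (i + 1 + 1) = v ∧
      w = fun j => if j ≤ i + 1 then 0 else z j}.Finite) → ∀ v, {w : ℕ → I | ∃ z ∈ relSequences R,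
        z (i + 1) = v ∧ w = fun j => if j ≤ i then 0 else z j}.Finite := by
      intro i ih v
      have hfin : ({x : I | (x : ℝ) = 5 * v} ∪ V (i + 1)).Finite := by
        refine Set.Finite.union (Set.Subsingleton.finite ?_) (hV _)
        intro x hx y hy
        exact Subtype.ext (hx.trans hy.symm)
      refine (hfin.biUnion fun x _ => (ih x).image fun w => Function.update w (i + 1) v).subset ?_
      rintro _ ⟨z, hz, rfl, rfl⟩
      refine mem_biUnion (hRV _ _ _ (hz (i + 1))) ⟨_, ⟨z, hz, rfl, rfl⟩, ?_⟩
      funext j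
      rcases lt_trichotomy j (i + 1) with hj | rfl | hj
      · simp [Function.update_of_ne hj.ne, hj.le, Nat.lt_succ_iff.mp hj]
      · simp
      · simp [Function.update_of_ne hj.ne', not_le.mpr hj, not_le.mpr (Nat.lt_of_succ_lt hj)]
    intro i
    rcases le_total n i with hi | hi
    · exact hbig i hi
    · exact Nat.decreasingInduction (motive := fun i _ => ∀ v, {w : ℕ → I | ∃ z ∈ relSequences R,
        z (i + 1) = v ∧ w = fun j => if j ≤ i then 0 else z j}.Finite)
        (fun i _ ih => hstep i ih) (hbig n le_rfl) hi
  let T : ℕ → Set (ℕ → I) := fun i => ⋃ v ∈ V i, {w : ℕ → I | ∃ z ∈ relSequences R,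
    z (i + 1) = v ∧ w = fun j => if j ≤ i then 0 else z j}
  have hT : ∀ i, (T i).Finite := fun i => (hV i).biUnion fun v _ => htail i v
  -- A sequence with nonzero start is sorted by the first index `i` at which it leaves the base
  -- line, where its next term is a vertex, and by its tail from there. Never leaving would give `z
  -- n = 5 ^ n * z 0`, which is nonzero. Within one class the sequences differ only by their height.
  let 𝒞 : Set (Set (relSequences R)) :=
    insert {z : relSequences R | (z : ℕ → I) 0 = 0} (⋃ i ∈ Finset.range n,
      (fun w => (Subtype.val ⁻¹' baseSegment w i : Set (relSequences R))) '' T i)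
  refine h.isTruncationSystem.subtype.isTopologicalTree ((nontrivial_univ_iff).mpr hnt.coe_sort)
    (𝒞 := 𝒞) (Set.Finite.insert _ ((Finset.finite_toSet _).biUnion fun i _ => (hT i).image _))
    ?_ ?_ ?_
  · rintro ⟨z, hz⟩ -
    by_cases hz0 : z 0 = 0
    · exact ⟨_, mem_insert _ _, hz0⟩
    have hex : ∃ i, (z (i + 1) : ℝ) ≠ 5 * z i := by
      by_contra! hall
      have hpow : ∀ i, (z i : ℝ) = 5 ^ i * z 0 := by
        intro i
        induction i with
        | zero => simp
        | succ i ih => rw [hall, ih, pow_succ]; ring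
      have := hpow n
      rw [hn z hz n le_rfl] at this
      refine hz0 (Subtype.ext ?_)
      simpa using this.symm
    classical
    let i := Nat.find hex
    have hi : (z (i + 1) : ℝ) ≠ 5 * z i := Nat.find_spec hex
    have hmin : ∀ j < i, (z (j + 1) : ℝ) = 5 * z j := fun j hj => not_not.mp (Nat.find_min hex hj)
    have hin : i < n := by
      by_contra! hni
      refine hi ?_
      rw [hn z hz i hni, hn z hz (i + 1) (by omega)]
      simp
    refine ⟨_, mem_insert_of_mem _ (mem_biUnion (Finset.mem_coe.mpr (Finset.mem_range.mpr hin))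
      ⟨fun j => if j ≤ i then 0 else z j, ?_, rfl⟩), ?_, ?_⟩
    · exact mem_biUnion ((hRV _ _ _ (hz i)).resolve_left hi) ⟨z, hz, rfl, rfl⟩
    · intro j hj
      induction j with
      | zero => simp
      | succ j ih => rw [hmin j hj, ih (Nat.le_of_succ_le hj), pow_succ]; ring
    · intro j hj
      simp [not_le.mpr hj]
  · intro C hC
    rcases hC with rfl | hC
    · exact isClosed_eq ((continuous_apply 0).comp continuous_subtype_val) continuous_const
    · simp only [mem_iUnion] at hC
      obtain ⟨i, -, w, -, rfl⟩ := hC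
      exact (isClosed_baseSegment w i).preimage continuous_subtype_val
  · rintro C hC ⟨z, hz⟩ ⟨-, hzC⟩ ⟨w, hw⟩ ⟨-, hwC⟩ hzw
    apply Subtype.ext
    funext j
    apply Subtype.ext
    have hzw' : (z 0 : ℝ) ≤ w 0 := hzw
    have hzj := h.le_pow_mul hz 0 j
    have hwj := h.le_pow_mul hw 0 j
    rw [zero_add] at hzj hwj
    simp only [coe_seqTrunc]
    have h5 : (0 : ℝ) < 5 ^ j := by positivity
    rcases hC with rfl | hC
    · have h0 : (z 0 : ℝ) = 0 := by
        rw [show z 0 = 0 from hzC]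
        rfl
      rw [h0] at hzj ⊢
      rw [mul_zero] at hzj ⊢
      rw [min_eq_right (w j).2.1]
      exact le_antisymm hzj (z j).2.1
    · simp only [mem_iUnion] at hC
      obtain ⟨i, -, v, -, rfl⟩ := hC
      by_cases hji : j ≤ i
      · rw [hwC.1 j hji, hzC.1 j hji, min_eq_right (by gcongr)]
      · have hj := not_le.mp hji
        have he : w j = z j := (hwC.2 j hj).trans (hzC.2 j hj).symm
        rw [he, min_eq_left hzj]

end IsToothed

end TruncatedSequences

/-! ### Collapsing the intervals of the finite stages of the Cantor set. -/

section Collapse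

/-- The measure of the part below `x` of the gaps `(1/5, 2/5)` and `(3/5, 4/5)`. -/
noncomputable def gapMeasure (x : ℝ) : ℝ :=
  min (max (x - 1 / 5) 0) (1 / 5) + min (max (x - 3 / 5) 0) (1 / 5)

/-- The monotone map that collapses the `3 ^ n` intervals of the `n`-th stage of the construction of the
Cantor set of expansions to the base `5` with digits `0`, `2`, `4`. -/
noncomputable def stageCollapse : ℕ → ℝ → ℝ
  | 0, _ => 0
  | n + 1, x => gapMeasure x +
      (stageCollapse n (5 * x) + stageCollapse n (5 * x - 2) + stageCollapse n (5 * x - 4)) / 5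

theorem gapMeasure_mono : Monotone gapMeasure := by
  intro x y h
  unfold gapMeasure
  gcongr

@[fun_prop]
theorem continuous_gapMeasure : Continuous gapMeasure := by
  unfold gapMeasure
  fun_prop

theorem gapMeasure_of_le {x : ℝ} (h : x ≤ 1 / 5) : gapMeasure x = 0 := by
  rw [gapMeasure, max_eq_right (by linarith), max_eq_right (by linarith)]
  norm_num

theorem gapMeasure_of_mem {x : ℝ} (h : 2 / 5 ≤ x) (h' : x ≤ 3 / 5) : gapMeasure x = 1 / 5 := by
  rw [gapMeasure, max_eq_left (by linarith), max_eq_right (by linarith),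
    min_eq_right (by linarith)]
  norm_num

theorem gapMeasure_of_ge {x : ℝ} (h : 4 / 5 ≤ x) : gapMeasure x = 2 / 5 := by
  rw [gapMeasure, max_eq_left (by linarith), max_eq_left (by linarith),
    min_eq_right (by linarith), min_eq_right (by linarith)]
  norm_num

theorem gapMeasure_of_mem_left {x : ℝ} (h : 1 / 5 ≤ x) (h' : x ≤ 2 / 5) :
    gapMeasure x = x - 1 / 5 := by
  rw [gapMeasure, max_eq_left (by linarith), max_eq_right (by linarith),
    min_eq_left (by linarith)]
  norm_num

theorem gapMeasure_of_mem_right {x : ℝ} (h : 3 / 5 ≤ x) (h' : x ≤ 4 / 5) :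
    gapMeasure x = x - 2 / 5 := by
  rw [gapMeasure, max_eq_left (by linarith), max_eq_left (by linarith),
    min_eq_right (by linarith), min_eq_left (by linarith)]
  ring

theorem stageCollapse_succ (n : ℕ) (x : ℝ) : stageCollapse (n + 1) x = gapMeasure x +
    (stageCollapse n (5 * x) + stageCollapse n (5 * x - 2) + stageCollapse n (5 * x - 4)) / 5 := rfl

theorem stageCollapse_mono (n : ℕ) : Monotone (stageCollapse n) := by
  induction n with
  | zero => exact monotone_const
  | succ n ih =>
    intro x y h
    rw [stageCollapse_succ, stageCollapse_succ]
    have h1 := gapMeasure_mono h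
    have h2 := ih (show 5 * x ≤ 5 * y by linarith)
    have h3 := ih (show 5 * x - 2 ≤ 5 * y - 2 by linarith)
    have h4 := ih (show 5 * x - 4 ≤ 5 * y - 4 by linarith)
    linarith

@[fun_prop]
theorem continuous_stageCollapse (n : ℕ) : Continuous (stageCollapse n) := by
  induction n with
  | zero => exact continuous_const
  | succ n ih =>
    have : stageCollapse (n + 1) = fun x => gapMeasure x +
      (stageCollapse n (5 * x) + stageCollapse n (5 * x - 2) + stageCollapse n (5 * x - 4)) / 5 := rfl
    rw [this]
    fun_prop

theorem stageCollapse_of_nonpos (n : ℕ) {x : ℝ} (hx : x ≤ 0) : stageCollapse n x = 0 := by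
  induction n generalizing x with
  | zero => rfl
  | succ n ih =>
    rw [stageCollapse_succ, gapMeasure_of_le (by linarith), ih (by linarith), ih (by linarith),
      ih (by linarith)]
    norm_num

theorem stageCollapse_of_one_le (n : ℕ) {x : ℝ} (hx : 1 ≤ x) : stageCollapse n x = stageCollapse n 1 := by
  induction n generalizing x with
  | zero => rfl
  | succ n ih =>
    rw [stageCollapse_succ, stageCollapse_succ, gapMeasure_of_ge (by linarith),
      gapMeasure_of_ge (by norm_num), ih (by linarith : 1 ≤ 5 * x), ih (by linarith : 1 ≤ 5 * x - 2),
      ih (by linarith : 1 ≤ 5 * x - 4), ih (by norm_num : (1 : ℝ) ≤ 5 * 1),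
      ih (by norm_num : (1 : ℝ) ≤ 5 * 1 - 2), ih (by norm_num : (1 : ℝ) ≤ 5 * 1 - 4)]

theorem stageCollapse_nonneg (n : ℕ) (x : ℝ) : 0 ≤ stageCollapse n x := by
  rcases le_total x 0 with hx | hx
  · rw [stageCollapse_of_nonpos n hx]
  · rw [← stageCollapse_of_nonpos n le_rfl]
    exact stageCollapse_mono n hx

theorem stageCollapse_le_one (n : ℕ) (x : ℝ) : stageCollapse n x ≤ 1 := by
  induction n generalizing x with
  | zero => exact zero_le_one
  | succ n ih =>
    have h1 : gapMeasure x ≤ 1 / 5 + 1 / 5 := add_le_add (min_le_right _ _) (min_le_right _ _)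
    have h2 := ih (5 * x)
    have h3 := ih (5 * x - 2)
    have h4 := ih (5 * x - 4)
    rw [stageCollapse_succ]
    linarith

theorem stageCollapse_succ_pos (n : ℕ) : 0 < stageCollapse (n + 1) 1 := by
  rw [stageCollapse_succ, gapMeasure_of_ge (by norm_num)]
  exact add_pos_of_pos_of_nonneg (by norm_num) (div_nonneg (add_nonneg (add_nonneg
    (stageCollapse_nonneg _ _) (stageCollapse_nonneg _ _)) (stageCollapse_nonneg _ _)) (by norm_num))

/-- On the interval of the digit `2 * d`, the map `stageCollapse (n + 1)` is a copy of `stageCollapse n`. -/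
theorem stageCollapse_succ_digit (n : ℕ) (d : Fin 3) {x : ℝ} (h0 : 0 ≤ x) (h1 : x ≤ 1) :
    stageCollapse (n + 1) ((2 * (d : ℕ) + x) / 5) =
      (d : ℕ) * (1 + stageCollapse n 1) / 5 + stageCollapse n x / 5 := by
  have hd : ((d : ℕ) : ℝ) = 0 ∨ ((d : ℕ) : ℝ) = 1 ∨ ((d : ℕ) : ℝ) = 2 := by
    fin_cases d <;> norm_num
  generalize ((d : ℕ) : ℝ) = r at hd ⊢
  rw [stageCollapse_succ, show 5 * ((2 * r + x) / 5) = 2 * r + x by ring]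
  rcases hd with rfl | rfl | rfl
  · rw [gapMeasure_of_le (by linarith), stageCollapse_of_nonpos n (x := 2 * 0 + x - 2) (by linarith),
      stageCollapse_of_nonpos n (x := 2 * 0 + x - 4) (by linarith), show 2 * 0 + x = x by ring]
    ring
  · rw [gapMeasure_of_mem (by linarith) (by linarith),
      stageCollapse_of_one_le n (x := 2 * 1 + x) (by linarith),
      stageCollapse_of_nonpos n (x := 2 * 1 + x - 4) (by linarith),
      show 2 * 1 + x - 2 = x by ring]
    ring
  · rw [gapMeasure_of_ge (by linarith), stageCollapse_of_one_le n (x := 2 * 2 + x) (by linarith),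
      stageCollapse_of_one_le n (x := 2 * 2 + x - 2) (by linarith),
      show 2 * 2 + x - 4 = x by ring]
    ring

/-- This is the digit 0 case of self-similarity. It makes collapsing by consecutive stages carry the
base line to the base line. -/
theorem stageCollapse_succ_of_eq (n : ℕ) {x y : ℝ} (hx : x = 5 * y) (h0 : 0 ≤ x) (h1 : x ≤ 1) :
    stageCollapse n x = 5 * stageCollapse (n + 1) y := by
  have := stageCollapse_succ_digit n 0 h0 h1
  rw [show (2 * ((0 : Fin 3) : ℕ) + x) / 5 = y by rw [hx]; simp] at this
  rw [this]
  simp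
  ring

/-- The later stage keeps all gaps of the earlier one and adds more. Hence stage `n` is a
1-Lipschitz function of stage `n + 1`, the source of the bonding maps. -/
theorem stageCollapse_sub_le (n : ℕ) {x y : ℝ} (h : x ≤ y) :
    stageCollapse n y - stageCollapse n x ≤ stageCollapse (n + 1) y - stageCollapse (n + 1) x := by
  induction n generalizing x y with
  | zero => simpa [stageCollapse] using gapMeasure_mono h
  | succ n ih =>
    rw [stageCollapse_succ (n + 1), stageCollapse_succ (n + 1), stageCollapse_succ n, stageCollapse_succ n]
    have h2 := ih (show 5 * x ≤ 5 * y by linarith)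
    have h3 := ih (show 5 * x - 2 ≤ 5 * y - 2 by linarith)
    have h4 := ih (show 5 * x - 4 ≤ 5 * y - 4 by linarith)
    linarith

theorem stageCollapse_eq_of_succ_eq (n : ℕ) {x y : ℝ} (h : stageCollapse (n + 1) x = stageCollapse (n + 1) y) :
    stageCollapse n x = stageCollapse n y := by
  wlog hxy : x ≤ y generalizing x y
  · exact (this h.symm (not_le.mp hxy).le).symm
  have h1 := stageCollapse_sub_le n hxy
  have h2 := stageCollapse_mono n hxy
  linarith

/-- Distinct points with equal values enclose no piece of a gap, so they share an interval of stage
`n`. In the induction they share a digit interval, which is rescaled by 5. -/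
theorem abs_sub_le_of_stageCollapse_eq (n : ℕ) {x y : ℝ} (hx : x ∈ Icc (0 : ℝ) 1)
    (hy : y ∈ Icc (0 : ℝ) 1) (h : stageCollapse n x = stageCollapse n y) : |x - y| ≤ (1 / 5) ^ n := by
  wlog hxy : x ≤ y generalizing x y
  · rw [abs_sub_comm]
    exact this hy hx h.symm (not_le.mp hxy).le
  rw [abs_sub_comm, abs_of_nonneg (by linarith)]
  induction n generalizing x y with
  | zero =>
    rw [pow_zero]
    linarith [hx.1, hy.2]
  | succ n ih =>
    rcases hxy.eq_or_lt with rfl | hlt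
    · rw [sub_self]
      positivity
    rw [stageCollapse_succ, stageCollapse_succ] at h
    have h1 := gapMeasure_mono hxy
    have h2 := stageCollapse_mono n (show 5 * x ≤ 5 * y by linarith)
    have h3 := stageCollapse_mono n (show 5 * x - 2 ≤ 5 * y - 2 by linarith)
    have h4 := stageCollapse_mono n (show 5 * x - 4 ≤ 5 * y - 4 by linarith)
    have hgap : gapMeasure x = gapMeasure y := by linarith
    have key : ∃ t : ℝ, 5 * x - t ∈ Icc (0 : ℝ) 1 ∧ 5 * y - t ∈ Icc (0 : ℝ) 1 ∧
        stageCollapse n (5 * x - t) = stageCollapse n (5 * y - t) := by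
      have hval : ∀ u ∈ Icc (0 : ℝ) 1, (u ≤ 1 / 5 ∧ gapMeasure u = 0) ∨
          (1 / 5 < u ∧ u < 2 / 5 ∧ gapMeasure u = u - 1 / 5) ∨
          (2 / 5 ≤ u ∧ u ≤ 3 / 5 ∧ gapMeasure u = 1 / 5) ∨
          (3 / 5 < u ∧ u < 4 / 5 ∧ gapMeasure u = u - 2 / 5) ∨
          (4 / 5 ≤ u ∧ gapMeasure u = 2 / 5) := by
        intro u _
        rcases le_or_gt u (1 / 5) with h1 | h1
        · exact Or.inl ⟨h1, gapMeasure_of_le h1⟩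
        rcases lt_or_ge u (2 / 5) with h2 | h2
        · exact Or.inr (Or.inl ⟨h1, h2, gapMeasure_of_mem_left h1.le h2.le⟩)
        rcases le_or_gt u (3 / 5) with h3 | h3
        · exact Or.inr (Or.inr (Or.inl ⟨h2, h3, gapMeasure_of_mem h2 h3⟩))
        rcases lt_or_ge u (4 / 5) with h4 | h4
        · exact Or.inr (Or.inr (Or.inr (Or.inl ⟨h3, h4, gapMeasure_of_mem_right h3.le h4.le⟩)))
        · exact Or.inr (Or.inr (Or.inr (Or.inr ⟨h4, gapMeasure_of_ge h4⟩)))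
      have hx0 := hx.1
      have hy1 := hy.2
      have hcases : y ≤ 1 / 5 ∨ (2 / 5 ≤ x ∧ y ≤ 3 / 5) ∨ 4 / 5 ≤ x := by
        rcases hval x hx with ⟨a, b⟩ | ⟨a, a', b⟩ | ⟨a, a', b⟩ | ⟨a, a', b⟩ | ⟨a, b⟩ <;>
        rcases hval y hy with ⟨c, d⟩ | ⟨c, c', d⟩ | ⟨c, c', d⟩ | ⟨c, c', d⟩ | ⟨c, d⟩ <;>
        first
        | exact Or.inl c
        | exact Or.inr (Or.inr a)
        | exact Or.inr (Or.inl ⟨a, c'⟩)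
        | (exfalso; linarith)
      rcases hcases with hc | ⟨hc, hc'⟩ | hc
      · refine ⟨0, ⟨by linarith, by linarith⟩, ⟨by linarith, by linarith⟩, ?_⟩
        rw [sub_zero, sub_zero]
        linarith
      · exact ⟨2, ⟨by linarith, by linarith⟩, ⟨by linarith, by linarith⟩, by linarith⟩
      · exact ⟨4, ⟨by linarith, by linarith⟩, ⟨by linarith, by linarith⟩, by linarith⟩
    obtain ⟨t, hxt, hyt, ht⟩ := key
    have := ih hxt hyt ht (by linarith)
    rw [pow_succ]
    linarith

theorem exists_continuous_stageCollapse_eq (n : ℕ) :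
    ∃ c : ℝ → ℝ, Continuous c ∧ ∀ x, c (stageCollapse (n + 1) x) = stageCollapse n x := by
  have hfac : Function.FactorsThrough (stageCollapse n) (stageCollapse (n + 1)) :=
    fun x y h => stageCollapse_eq_of_succ_eq n h
  have hlip : LipschitzOnWith 1 (Function.extend (stageCollapse (n + 1)) (stageCollapse n) 0)
      (range (stageCollapse (n + 1))) := by
    refine LipschitzOnWith.of_dist_le_mul ?_
    rintro _ ⟨x, rfl⟩ _ ⟨y, rfl⟩
    rw [hfac.extend_apply, hfac.extend_apply, NNReal.coe_one, one_mul]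
    wlog hxy : x ≤ y generalizing x y
    · rw [dist_comm, dist_comm (stageCollapse (n + 1) x)]
      exact this y x (not_le.mp hxy).le
    have h1 := stageCollapse_sub_le n hxy
    have h2 := stageCollapse_mono n hxy
    have h3 := stageCollapse_mono (n + 1) hxy
    rw [dist_comm, dist_comm (stageCollapse (n + 1) x), Real.dist_eq, Real.dist_eq,
      abs_of_nonneg (by linarith), abs_of_nonneg (by linarith)]
    exact h1
  obtain ⟨c, hc, heq⟩ := hlip.extend_real
  refine ⟨c, hc.continuous, fun x => ?_⟩
  rw [← heq ⟨x, rfl⟩, hfac.extend_apply]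

end Collapse

/-! ### The Cantor set, the heights of the teeth, and the set-valued function. -/

section ToothFunction

/-- The point of the Cantor set with the expansion `2 * s 0, 2 * s 1, …` to the base `5`. -/
noncomputable def cantorPoint (s : ℕ → Fin 3) : ℝ :=
  Real.ofDigits fun i => (![0, 2, 4] (s i) : Fin 5)

theorem cantorPoint_nonneg (s : ℕ → Fin 3) : 0 ≤ cantorPoint s := Real.ofDigits_nonneg _

theorem cantorPoint_le_one (s : ℕ → Fin 3) : cantorPoint s ≤ 1 := Real.ofDigits_le_one _

theorem continuous_cantorPoint : Continuous cantorPoint := by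
  refine Real.continuous_ofDigits.comp (continuous_pi fun i => ?_)
  exact (continuous_of_discreteTopology (f := (![0, 2, 4] : Fin 3 → Fin 5))).comp
    (continuous_apply i)

theorem cantorPoint_sub_of_eq {s t : ℕ → Fin 3} {n : ℕ} (h : ∀ i < n, s i = t i) :
    cantorPoint s - cantorPoint t =
      (5 ^ n)⁻¹ * (cantorPoint (fun i => s (i + n)) - cantorPoint fun i => t (i + n)) := by
  have hsum : ∀ u : ℕ → Fin 3, cantorPoint u =
      (∑ i ∈ Finset.range n, (((![0, 2, 4] (u i) : Fin 5) : ℕ) : ℝ) * (5 ^ (i + 1))⁻¹) +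
        (5 ^ n)⁻¹ * cantorPoint fun i => u (i + n) := by
    intro u
    have := Real.ofDigits_eq_sum_add_ofDigits (fun i => (![0, 2, 4] (u i) : Fin 5)) n
    simpa only [cantorPoint, Real.ofDigitsTerm, Nat.cast_ofNat] using this
  rw [hsum s, hsum t, Finset.sum_congr rfl fun i hi => by rw [h i (Finset.mem_range.mp hi)]]
  ring

theorem cantorPoint_eq (s : ℕ → Fin 3) :
    cantorPoint s = (2 * (s 0 : ℕ) + cantorPoint fun i => s (i + 1)) / 5 := by
  have hd : ∀ d : Fin 3, (((![0, 2, 4] d : Fin 5) : ℕ) : ℝ) = 2 * (d : ℕ) := by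
    intro d
    fin_cases d <;> norm_num
  unfold cantorPoint
  rw [Real.ofDigits_eq_sum_add_ofDigits _ 1, Finset.sum_range_one, Real.ofDigitsTerm, hd]
  push_cast
  ring

theorem cantorPoint_one : cantorPoint (fun _ => 1) = 1 / 2 := by
  have := cantorPoint_eq fun _ => 1
  norm_num at this
  linarith

/-- The heights of the cylinders of digit sequences: a digit other than `1` at the place `n` shrinks the height by
the factor `(n + 1) / (n + 2)`. -/
noncomputable def cylinderHeight (s : ℕ → Fin 3) : ℕ → ℝ
  | 0 => 1
  | n + 1 => cylinderHeight s n * if s n = 1 then 1 else ((n : ℝ) + 1) / (n + 2)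

theorem cylinderHeight_succ (s : ℕ → Fin 3) (n : ℕ) : cylinderHeight s (n + 1) =
    cylinderHeight s n * if s n = 1 then 1 else ((n : ℝ) + 1) / (n + 2) := rfl

theorem continuous_cylinderHeight (n : ℕ) : Continuous fun s => cylinderHeight s n := by
  induction n with
  | zero => exact continuous_const
  | succ n ih =>
    simp only [cylinderHeight_succ]
    exact ih.mul ((continuous_of_discreteTopology
      (f := fun d : Fin 3 => if d = 1 then (1 : ℝ) else ((n : ℝ) + 1) / (n + 2))).comp
      (continuous_apply n))

theorem cylinderHeight_congr {s t : ℕ → Fin 3} {n : ℕ} (h : ∀ i < n, s i = t i) :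
    cylinderHeight s n = cylinderHeight t n := by
  induction n with
  | zero => rfl
  | succ n ih =>
    rw [cylinderHeight_succ, cylinderHeight_succ, ih fun i hi => h i (hi.trans n.lt_succ_self),
      h n n.lt_succ_self]

theorem cylinderHeight_one (n : ℕ) : cylinderHeight (fun _ => 1) n = 1 := by
  induction n with
  | zero => rfl
  | succ n ih => rw [cylinderHeight_succ, ih]; simp

/-- The factors telescope; the bound tends to 0 as `n` grows. -/
theorem cylinderHeight_le {s : ℕ → Fin 3} {m : ℕ} (h : ∀ i, m ≤ i → s i ≠ 1) {n : ℕ} (hmn : m ≤ n)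
    (h0 : cylinderHeight s m ≤ 1) : cylinderHeight s n ≤ (m + 1) / (n + 1) := by
  induction n, hmn using Nat.le_induction with
  | base => rwa [div_self (by positivity)]
  | succ n hn ih =>
    rw [cylinderHeight_succ, if_neg (h n hn)]
    calc cylinderHeight s n * (((n : ℝ) + 1) / (n + 2))
        ≤ ((m : ℝ) + 1) / (n + 1) * ((n + 1) / (n + 2)) := by gcongr
      _ = (m + 1) / ((n + 1 : ℕ) + 1) := by
        push_cast
        field_simp
        norm_num [add_assoc]

theorem cylinderHeight_le_one (s : ℕ → Fin 3) (n : ℕ) :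
    0 ≤ cylinderHeight s n ∧ cylinderHeight s n ≤ 1 := by
  induction n with
  | zero => exact ⟨zero_le_one, le_rfl⟩
  | succ n ih =>
    have h0 : (0 : ℝ) ≤ if s n = 1 then 1 else ((n : ℝ) + 1) / (n + 2) := by
      split_ifs <;> positivity
    have h1 : (if s n = 1 then (1 : ℝ) else ((n : ℝ) + 1) / (n + 2)) ≤ 1 := by
      split_ifs
      · exact le_rfl
      · rw [div_le_one (by positivity)]
        linarith
    exact ⟨mul_nonneg ih.1 h0, mul_le_one₀ ih.2 h0 h1⟩

/-- A sequence over which there is a tooth of positive height takes the value `1` infinitely often. -/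
theorem exists_eq_one_of_le_cylinderHeight {s : ℕ → Fin 3} {z : ℝ} (hz : 0 < z)
    (h : ∀ n, z ≤ cylinderHeight s n) (m : ℕ) : ∃ n, m ≤ n ∧ s n = 1 := by
  by_contra! hne
  obtain ⟨k, hk⟩ := exists_nat_gt (((m : ℝ) + 1) / z)
  have h1 := (h (max m k)).trans (cylinderHeight_le (fun i hi => hne i hi) (le_max_left m k)
    (cylinderHeight_le_one s m).2)
  have h2 : (k : ℝ) ≤ (max m k : ℕ) := by exact_mod_cast le_max_right m k
  rw [le_div_iff₀ (by positivity)] at h1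
  rw [div_lt_iff₀ hz] at hk
  nlinarith

/-- The sequence `s` with the digit `d` at the place `n` and digits `1` after it. -/
def changeDigit (s : ℕ → Fin 3) (n : ℕ) (d : Fin 3) : ℕ → Fin 3 := fun i =>
  if i < n then s i else if i = n then d else 1

theorem cantorPoint_changeDigit_sub {s : ℕ → Fin 3} {n : ℕ} (d : Fin 3) :
    cantorPoint (changeDigit s n d) - cantorPoint s = (5 ^ n)⁻¹ *
      ((2 * ((d : ℕ) - (s n : ℕ)) + 1 / 2 - cantorPoint fun i => s (i + 1 + n)) / 5) := by
  rw [cantorPoint_sub_of_eq (n := n) fun i hi => by simp [changeDigit, hi],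
    cantorPoint_eq, cantorPoint_eq fun i => s (i + n)]
  have h1 : (fun i => changeDigit s n d (i + 1 + n)) = fun _ => 1 := by
    funext i
    simp [changeDigit]
  rw [h1, cantorPoint_one]
  simp [changeDigit]
  ring

/-- Earlier digits are unchanged and later ones are free, so only place `n` can cost height. -/
theorem le_cylinderHeight_changeDigit {s : ℕ → Fin 3} {z : ℝ} (hz : 0 ≤ z)
    (h : ∀ n, z ≤ cylinderHeight s n) (n : ℕ) (d : Fin 3) (k : ℕ) :
    z * ((n + 1) / (n + 2)) ≤ cylinderHeight (changeDigit s n d) k := by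
  have hfac : ((n : ℝ) + 1) / (n + 2) ≤ 1 := by
    rw [div_le_one (by positivity)]
    linarith
  have hfac0 : (0 : ℝ) ≤ ((n : ℝ) + 1) / (n + 2) := by positivity
  have hlow : ∀ k ≤ n, z ≤ cylinderHeight (changeDigit s n d) k := by
    intro k hk
    rw [cylinderHeight_congr (t := s) fun i hi => by simp [changeDigit, hi.trans_le hk]]
    exact h k
  rcases le_or_gt k n with hk | hk
  · exact (mul_le_of_le_one_right hz hfac).trans (hlow k hk)
  · induction k, (hk : n + 1 ≤ k) using Nat.le_induction with
    | base =>
      rw [cylinderHeight_succ]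
      refine mul_le_mul (hlow n le_rfl) ?_ hfac0 (hz.trans (hlow n le_rfl))
      split_ifs
      · exact hfac
      · exact le_rfl
    | succ k hk' ih =>
      rw [cylinderHeight_succ, if_pos, mul_one]
      · exact ih
      · have : ¬ k < n := by omega
        have : k ≠ n := by omega
        simp [changeDigit, *]

/-- On either side of a point of the Cantor set there are points arbitrarily close to it with
almost the same height. -/
theorem exists_cantorPoint_near {s : ℕ → Fin 3} {w z : ℝ} (hw : 0 ≤ w) (hwz : w < z)
    (h : ∀ n, z ≤ cylinderHeight s n) {ε : ℝ} (hε : 0 < ε) :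
    (∃ t, cantorPoint s < cantorPoint t ∧ cantorPoint t < cantorPoint s + ε ∧
      ∀ n, w ≤ cylinderHeight t n) ∧
    ∃ t, cantorPoint s - ε < cantorPoint t ∧ cantorPoint t < cantorPoint s ∧
      ∀ n, w ≤ cylinderHeight t n := by
  have hz : 0 < z := hw.trans_lt hwz
  obtain ⟨k, hk⟩ := exists_nat_gt (z / (z - w))
  obtain ⟨l, hl⟩ := exists_pow_lt_of_lt_one hε (by norm_num : (1 / 5 : ℝ) < 1)
  -- The bound `k` keeps the loss of height below `z - w`, and `l` keeps the displacement below `ε`.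
  -- A middle digit at `n` can be both raised to 2 and lowered to 0.
  obtain ⟨n, hn, hsn⟩ := exists_eq_one_of_le_cylinderHeight hz h (max k l)
  have hpow : ((5 : ℝ) ^ n)⁻¹ < ε := by
    rw [← inv_pow, inv_eq_one_div]
    exact (pow_le_pow_of_le_one (by norm_num) (by norm_num) ((le_max_right k l).trans hn)).trans_lt hl
  have hpos : (0 : ℝ) < (5 ^ n)⁻¹ := by positivity
  have hheight : ∀ d k, w ≤ cylinderHeight (changeDigit s n d) k := by
    intro d k'
    refine le_trans ?_ (le_cylinderHeight_changeDigit hz.le h n d k')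
    have hkn : (k : ℝ) ≤ n := by exact_mod_cast (le_max_left k l).trans hn
    rw [div_lt_iff₀ (by linarith)] at hk
    rw [← mul_div_assoc, le_div_iff₀ (by positivity)]
    nlinarith
  have h0 := cantorPoint_nonneg fun i => s (i + 1 + n)
  have h1 := cantorPoint_le_one fun i => s (i + 1 + n)
  constructor
  · have hsub := cantorPoint_changeDigit_sub (s := s) (n := n) 2
    rw [hsn] at hsub
    norm_num at hsub
    refine ⟨changeDigit s n 2, ?_, ?_, hheight 2⟩
    · nlinarith
    · nlinarith
  · have hsub := cantorPoint_changeDigit_sub (s := s) (n := n) 0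
    rw [hsn] at hsub
    norm_num at hsub
    refine ⟨changeDigit s n 0, ?_, ?_, hheight 0⟩
    · nlinarith
    · nlinarith

/-- Each stage of the collapse takes finitely many values on the Cantor set. -/
theorem finite_range_stageCollapse (n : ℕ) :
    (range fun s => stageCollapse n (cantorPoint s)).Finite := by
  induction n with
  | zero => exact (finite_singleton 0).subset (by rintro _ ⟨s, rfl⟩; rfl)
  | succ n ih =>
    refine (Set.Finite.image2 (fun (d : Fin 3) (v : ℝ) =>
      (d : ℕ) * (1 + stageCollapse n 1) / 5 + v / 5) finite_univ ih).subset ?_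
    rintro _ ⟨s, rfl⟩
    refine ⟨s 0, mem_univ _, _, ⟨fun i => s (i + 1), rfl⟩, ?_⟩
    simp only
    rw [← stageCollapse_succ_digit n (s 0) (cantorPoint_nonneg _) (cantorPoint_le_one _),
      ← cantorPoint_eq]

/-- The line `y = x / 5` with teeth over the points of the Cantor set. -/
def toothGraph : Set (I × I) :=
  {q | (q.1 : ℝ) = 5 * q.2} ∪ {q | (q.1 : ℝ) ≤ 5 * q.2} ∩
    {q | ∃ s, cantorPoint s = q.1 ∧ ∀ n, (q.2 : ℝ) ≤ cylinderHeight s n}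

/-- Each `cylinderHeight` depends on finitely many digits, so the height condition is closed on the
compact space of digit sequences, and the teeth come from a projection of a compact set. -/
theorem isClosed_toothGraph : IsClosed toothGraph := by
  refine (isClosed_eq (by fun_prop) (by fun_prop)).union
    ((isClosed_le (by fun_prop) (by fun_prop)).inter ?_)
  have hcl : IsClosed {r : (ℕ → Fin 3) × I × I |
      cantorPoint r.1 = r.2.1 ∧ ∀ n, (r.2.2 : ℝ) ≤ cylinderHeight r.1 n} := by
    have heq : {r : (ℕ → Fin 3) × I × I |
        cantorPoint r.1 = r.2.1 ∧ ∀ n, (r.2.2 : ℝ) ≤ cylinderHeight r.1 n} =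
        {r | cantorPoint r.1 = r.2.1} ∩ ⋂ n, {r | (r.2.2 : ℝ) ≤ cylinderHeight r.1 n} := by
      ext r
      simp
    rw [heq]
    exact (isClosed_eq (continuous_cantorPoint.comp continuous_fst) (by fun_prop)).inter
      (isClosed_iInter fun n => isClosed_le (by fun_prop)
        ((continuous_cylinderHeight n).comp continuous_fst))
  convert (hcl.isCompact.image continuous_snd).isClosed using 1
  ext q
  constructor
  · rintro ⟨s, hs⟩
    exact ⟨(s, q), hs, rfl⟩
  · rintro ⟨r, hr, rfl⟩
    exact ⟨r.1, hr⟩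

theorem le_of_mem_toothGraph {x y : I} (h : (x, y) ∈ toothGraph) : (x : ℝ) ≤ 5 * y := by
  rcases h with h | h
  · exact le_of_eq h
  · exact h.1

theorem toothGraph_segment {x y y' : I} (h : (x, y) ∈ toothGraph) (hx : (x : ℝ) ≤ 5 * y')
    (hy : y' ≤ y) : (x, y') ∈ toothGraph := by
  have hy' : (y' : ℝ) ≤ y := hy
  rcases h with h | ⟨-, s, hs, hsy⟩
  · exact Or.inl (le_antisymm hx (by rw [show (x : ℝ) = 5 * y from h]; linarith))
  · exact Or.inr ⟨hx, s, hs, fun n => hy'.trans (hsy n)⟩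

/-- The set-valued function whose graph is `toothGraph`. -/
noncomputable def toothFunction (x : I) : NonemptyCompacts I where
  carrier := {y | (x, y) ∈ toothGraph}
  isCompact' := (isClosed_toothGraph.preimage (by fun_prop)).isCompact
  nonempty' := ⟨⟨x / 5, by have := x.2.1; positivity, by linarith [x.2.1, x.2.2]⟩,
    Or.inl (by simp only [mem_ofPred_eq]; ring)⟩

theorem upperHemicontinuous_toothFunction :
    UpperHemicontinuous fun x => (toothFunction x : Set I) := by
  rw [upperHemicontinuous_iff_forall_isOpen]
  intro x u hu hxu
  have hcl : IsClosed (Prod.fst '' (toothGraph ∩ Prod.snd ⁻¹' uᶜ)) :=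
    ((isClosed_toothGraph.inter (hu.isClosed_compl.preimage continuous_snd)).isCompact.image
      continuous_fst).isClosed
  have hx : x ∈ (Prod.fst '' (toothGraph ∩ Prod.snd ⁻¹' uᶜ))ᶜ := by
    rintro ⟨⟨_, y⟩, ⟨hxy, hy⟩, rfl⟩
    exact hy (hxu hxy)
  filter_upwards [hcl.isOpen_compl.mem_nhds hx] with x' hx' y hy
  by_contra hyu
  exact hx' ⟨(x', y), ⟨hy, hyu⟩, rfl⟩

theorem mem_toothFunction_of_cantorPoint {s : ℕ → Fin 3} {x y : I} (hx : cantorPoint s = x)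
    (hxy : (x : ℝ) ≤ 5 * y) (h : ∀ n, (y : ℝ) ≤ cylinderHeight s n) : y ∈ toothFunction x :=
  Or.inr ⟨hxy, s, hx, h⟩

theorem setValuedSurjective_toothFunction : SetValuedSurjective toothFunction := by
  intro y
  rcases le_total (y : ℝ) (1 / 5) with hy | hy
  · refine ⟨⟨5 * y, by have := y.2.1; positivity, by linarith⟩, Or.inl rfl⟩
  · exact ⟨⟨1 / 2, by norm_num, by norm_num⟩,
      mem_toothFunction_of_cantorPoint cantorPoint_one (by simp only; linarith)
      fun n => by rw [cylinderHeight_one]; exact y.2.2⟩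

theorem exists_Icc_subset_of_nonempty_interior {s : Set I} (h : (interior s).Nonempty) :
    ∃ y z : I, y < z ∧ Icc y z ⊆ s := by
  obtain ⟨x, hx⟩ := h
  obtain ⟨y, hy⟩ | h := exists_or_forall_not fun y => y < x
  · obtain ⟨l, hl, hl'⟩ := exists_Ioc_subset_of_mem_nhds (isOpen_interior.mem_nhds hx) ⟨y, hy⟩
    obtain ⟨c, hc⟩ := exists_between hl
    exact ⟨c, x, hc.2, fun u hu => interior_subset (hl' ⟨hc.1.trans_le hu.1, hu.2⟩)⟩
  · have hx0 : x = 0 := le_antisymm (not_lt.mp (h 0)) nonneg'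
    obtain ⟨l, hl, hl'⟩ := exists_Ico_subset_of_mem_nhds (isOpen_interior.mem_nhds hx)
      ⟨1, hx0 ▸ zero_lt_one⟩
    obtain ⟨c, hc⟩ := exists_between hl
    exact ⟨x, c, hc.1, fun u hu => interior_subset (hl' ⟨hu.1, hu.2.trans_lt hc.2⟩)⟩

theorem Set.Finite.interior_eq_empty_of_unitInterval {s : Set I} (hs : s.Finite) :
    interior s = ∅ := by
  by_contra hne
  obtain ⟨y, z, hyz, hsub⟩ :=
    exists_Icc_subset_of_nonempty_interior (nonempty_iff_ne_empty.mpr hne)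
  exact Icc_infinite hyz (hs.subset hsub)

/-- On an interval inside the Cantor set every stage of the collapse would be continuous with
finitely many values, hence constant, which forces the endpoints to coincide. -/
theorem interior_range_cantorPoint : interior {x : I | ∃ s, cantorPoint s = x} = ∅ := by
  by_contra hne
  obtain ⟨y, z, hyz, hsub⟩ :=
    exists_Icc_subset_of_nonempty_interior (nonempty_iff_ne_empty.mpr hne)
  have hconst : ∀ n, stageCollapse n y = stageCollapse n z := by
    intro n
    have hfin : ((fun u : I => stageCollapse n u) '' Icc y z).Finite := by
      refine (finite_range_stageCollapse n).subset ?_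
      rintro _ ⟨u, hu, rfl⟩
      obtain ⟨s, hs⟩ := hsub hu
      exact ⟨s, by simp only [hs]⟩
    have hpre : IsPreconnected ((fun u : I => stageCollapse n u) '' Icc y z) :=
      isPreconnected_Icc.image _ (by fun_prop)
    exact (hfin.countable.isTotallyDisconnected) _ subset_rfl hpre
      ⟨y, ⟨le_rfl, hyz.le⟩, rfl⟩ ⟨z, ⟨hyz.le, le_rfl⟩, rfl⟩
  have hlt : (0 : ℝ) < |(y : ℝ) - z| := abs_pos.mpr (sub_ne_zero.mpr fun h => hyz.ne (Subtype.ext h))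
  obtain ⟨n, hn⟩ := exists_pow_lt_of_lt_one hlt (by norm_num : (1 / 5 : ℝ) < 1)
  exact absurd (abs_sub_le_of_stageCollapse_eq n y.2 z.2 (hconst n)) (not_le.mpr hn)

theorem isLight_toothFunction : IsLight toothFunction := by
  intro y
  have hsub : {x : I | y ∈ toothFunction x} ⊆
      {x : I | (x : ℝ) = 5 * y} ∪ {x : I | ∃ s, cantorPoint s = x} := by
    rintro x (h | h)
    · exact Or.inl h
    · exact Or.inr ⟨h.2.choose, h.2.choose_spec.1⟩
  have hss : {x : I | (x : ℝ) = 5 * y}.Subsingleton := fun a ha b hb =>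
    Subtype.ext (Eq.trans ha hb.symm)
  refine subset_eq_empty (interior_mono hsub) ?_
  rw [interior_union_isClosed_of_interior_empty
    (isClosed_eq continuous_subtype_val continuous_const) interior_range_cantorPoint]
  exact hss.finite.interior_eq_empty_of_unitInterval

theorem interior_setValuedGraph_toothFunction :
    interior (setValuedGraph toothFunction) = ∅ := by
  by_contra hne
  obtain ⟨⟨x, y⟩, hxy⟩ := nonempty_iff_ne_empty.mpr hne
  have hopen : IsOpen ((fun x' : I => (x', y)) ⁻¹' interior (setValuedGraph toothFunction)) :=
    isOpen_interior.preimage (by fun_prop)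
  have hsub : (fun x' : I => (x', y)) ⁻¹' interior (setValuedGraph toothFunction) ⊆
      {x' : I | y ∈ toothFunction x'} := fun x' hx' =>
    interior_subset (s := setValuedGraph toothFunction) hx'
  have hmem : x ∈ interior {x' : I | y ∈ toothFunction x'} := interior_maximal hsub hopen hxy
  rw [isLight_toothFunction y] at hmem
  exact hmem

/-- The intermediate value property near a tooth: a height `w` strictly below a point of the tooth
is attained by teeth arbitrarily close to `x`, on the side of `x'`. To the right the base line
rises, so `w` must start strictly above it. -/
theorem exists_mem_toothFunction_of_lt {x y w x' : I} (hxy : y ∈ toothFunction x)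
    (hxw : (x : ℝ) ≤ 5 * w) (hxw' : x < x' → (x : ℝ) < 5 * w) (hwy : w < y) (hx : x' ≠ x) : ∃ u ∈ uIoo x' x, w ∈ toothFunction u := by
  rcases hxy with hxy | ⟨-, s, hs, hsy⟩
  · have hwy' : (w : ℝ) < y := hwy
    have hxy' : (x : ℝ) = 5 * y := hxy
    linarith
  have hw0 := w.2.1
  rcases hx.lt_or_gt with hlt | hlt
  · have hlt' : (x' : ℝ) < x := hlt
    obtain ⟨-, t, ht1, ht2, ht⟩ := exists_cantorPoint_near hw0 hwy hsy (sub_pos.mpr hlt')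
    rw [hs] at ht1 ht2
    refine ⟨⟨cantorPoint t, cantorPoint_nonneg t, cantorPoint_le_one t⟩, ?_,
      mem_toothFunction_of_cantorPoint rfl (by simp only; linarith) ht⟩
    rw [uIoo_of_lt hlt]
    exact ⟨Subtype.coe_lt_coe.mp (by simp only; linarith), Subtype.coe_lt_coe.mp ht2⟩
  · have hlt' : (x : ℝ) < x' := hlt
    obtain ⟨⟨t, ht1, ht2, ht⟩, -⟩ := exists_cantorPoint_near hw0 hwy hsy
      (lt_min (sub_pos.mpr hlt') (sub_pos.mpr (hxw' hlt)))
    rw [hs] at ht1 ht2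
    have h1 := min_le_left ((x' : ℝ) - x) (5 * w - x)
    have h2 := min_le_right ((x' : ℝ) - x) (5 * w - x)
    refine ⟨⟨cantorPoint t, cantorPoint_nonneg t, cantorPoint_le_one t⟩, ?_,
      mem_toothFunction_of_cantorPoint rfl (by simp only; linarith) ht⟩
    rw [uIoo_of_gt hlt]
    exact ⟨Subtype.coe_lt_coe.mp ht1, Subtype.coe_lt_coe.mp (by simp only; linarith)⟩

theorem hasIntermediateValueProperty_toothFunction :
    HasIntermediateValueProperty toothFunction := by
  have key : ∀ x₁ x₂ y₁ y₂ : I, x₁ < x₂ → y₁ ≠ y₂ → y₁ ∈ toothFunction x₁ →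
      y₂ ∈ toothFunction x₂ → ∀ y ∈ uIoo y₁ y₂, ∃ x ∈ uIoo x₁ x₂, y ∈ toothFunction x := by
    intro x₁ x₂ y₁ y₂ hx hy h₁ h₂ y hyy
    have hx' : (x₁ : ℝ) < x₂ := hx
    have hl₁ := le_of_mem_toothGraph h₁
    have hl₂ := le_of_mem_toothGraph h₂
    rcases hy.lt_or_gt with hlt | hlt
    · rw [uIoo_of_lt hlt] at hyy
      have hy₁ : (y₁ : ℝ) < y := hyy.1
      have hy₂ : (y : ℝ) < y₂ := hyy.2
      -- Either `y` lies on the tooth over `x₂`, and a neighbouring tooth is used, or the base line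
      -- attains `y` at `5 * y`, which exceeds `5 * y₁` and hence `x₁`.
      rcases le_or_gt (x₂ : ℝ) (5 * y) with h | h
      · exact exists_mem_toothFunction_of_lt h₂ h (fun h' => absurd hx h'.not_gt) hyy.2 hx.ne
      · refine ⟨⟨5 * y, by linarith [y.2.1], by linarith [x₂.2.2]⟩, ?_, Or.inl rfl⟩
        rw [uIoo_of_lt hx]
        exact ⟨Subtype.coe_lt_coe.mp (by simp only; linarith), Subtype.coe_lt_coe.mp h⟩
    · rw [uIoo_of_gt hlt] at hyy
      have hy₂ : (y₂ : ℝ) < y := hyy.1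
      have h := exists_mem_toothFunction_of_lt h₁ (by linarith) (fun _ => by linarith) hyy.2 hx.ne'
      rwa [uIoo_comm] at h
  intro x₁ x₂ y₁ y₂ hx hy h₁ h₂ y hyy
  rcases hx.lt_or_gt with hlt | hlt
  · exact key x₁ x₂ y₁ y₂ hlt hy h₁ h₂ y hyy
  · rw [uIoo_comm] at hyy ⊢
    exact key x₂ x₁ y₂ y₁ hlt hy.symm h₂ h₁ y hyy

theorem exists_hasPeriod_toothFunction {n : ℕ} (hn : 0 < n) :
    ∃ x : ℕ → I, IsOrbit toothFunction x ∧ HasPeriod x n := by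
  -- The single change at place 1 costs the factor 2/3, and 2/3 exceeds 29/50. So the teeth over 1/2
  -- and 29/50 each contain both points, and every sequence of these two points is an orbit.
  let t : ℕ → Fin 3 := fun i => if i = 1 then 2 else 1
  have ht : cantorPoint t = 29 / 50 := by
    have h : (fun i => t (i + 1 + 1)) = fun _ => 1 := by
      funext i
      simp [t]
    rw [cantorPoint_eq, cantorPoint_eq fun i => t (i + 1), h, cantorPoint_one]
    simp [t]
    norm_num
  have htm : ∀ k, (2 / 3 : ℝ) ≤ cylinderHeight t k := by
    intro k
    have h := le_cylinderHeight_changeDigit (s := fun _ => 1) zero_le_one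
      (fun n => (cylinderHeight_one n).ge) 1 2 k
    have he : changeDigit (fun _ => 1) 1 2 = t := by
      funext i
      by_cases h0 : i < 1
      · simp [changeDigit, t, h0, show i ≠ 1 by omega]
      · simp [changeDigit, t, h0]
    rw [he] at h
    norm_num at h
    exact h
  let p : I := ⟨1 / 2, by norm_num, by norm_num⟩
  let q : I := ⟨29 / 50, by norm_num, by norm_num⟩
  have hall : ∀ u v : I, u = p ∨ u = q → v = p ∨ v = q → v ∈ toothFunction u := by
    rintro u v (rfl | rfl) hv
    · refine mem_toothFunction_of_cantorPoint cantorPoint_one ?_ fun n => ?_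
      · rcases hv with rfl | rfl <;> norm_num [p, q]
      · rw [cylinderHeight_one]
        exact v.2.2
    · refine mem_toothFunction_of_cantorPoint ht ?_ fun n => le_trans ?_ (htm n)
      · rcases hv with rfl | rfl <;> norm_num [p, q]
      · rcases hv with rfl | rfl <;> norm_num [p, q]
  have hpq : p ≠ q := fun h => by
    have := congrArg Subtype.val h
    norm_num [p, q] at this
  have hval : ∀ i, (if n ∣ i then q else p) = p ∨ (if n ∣ i then q else p) = q := fun i => by
    split_ifs <;> simp
  refine ⟨fun i => if n ∣ i then q else p, fun i => hall _ _ (hval i) (hval (i + 1)),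
    ⟨hn, fun i => by simp⟩, ?_⟩
  rintro m ⟨hm, hper⟩
  have h0 := hper 0
  by_contra hmn
  have hnd : ¬ n ∣ m := fun hd => hmn (Nat.le_of_dvd hm hd)
  simp [hnd] at h0
  exact hpq h0

end ToothFunction

/-! ### The stage trees and their inverse limit. -/

section StageTrees

/-- The map `stageCollapse n` as a map of the unit interval. -/
noncomputable def stageMap (n : ℕ) (x : I) : I :=
  ⟨stageCollapse n x, stageCollapse_nonneg n x, stageCollapse_le_one n x⟩

@[simp]
theorem coe_stageMap (n : ℕ) (x : I) : (stageMap n x : ℝ) = stageCollapse n x := rfl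

@[fun_prop]
theorem continuous_stageMap (n : ℕ) : Continuous (stageMap n) :=
  ((continuous_stageCollapse n).comp continuous_subtype_val).subtype_mk _

theorem stageMap_mono (n : ℕ) : Monotone (stageMap n) := fun _ _ h => stageCollapse_mono n h

theorem stageMap_zero_left (x : I) : stageMap 0 x = 0 := rfl

theorem stageMap_zero (n : ℕ) : stageMap n 0 = 0 :=
  Subtype.ext (stageCollapse_of_nonpos n le_rfl)

theorem abs_sub_le_of_stageMap_eq {n : ℕ} {x y : I} (h : stageMap n x = stageMap n y) :
    |(x : ℝ) - y| ≤ (1 / 5) ^ n :=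
  abs_sub_le_of_stageCollapse_eq n x.2 y.2 (congrArg Subtype.val h)

/-- The stages `n - i` and `n + 1 - i` are consecutive or both trivial, and intertwine the division by `5`. -/
theorem stageMap_sub_of_eq (n i : ℕ) {x y : I} (h : (x : ℝ) = 5 * y) :
    (stageMap (n - i) x : ℝ) = 5 * stageMap (n + 1 - i) y := by
  rcases le_or_gt i n with hi | hi
  · rw [Nat.sub_add_comm hi]
    exact stageCollapse_succ_of_eq _ h x.2.1 x.2.2
  · rw [Nat.sub_eq_zero_of_le hi.le, Nat.sub_eq_zero_of_le hi]
    simp [stageMap_zero_left]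

theorem exists_continuous_stageMap_eq (n i : ℕ) :
    ∃ c : I → I, Continuous c ∧ ∀ x, c (stageMap (n + 1 - i) x) = stageMap (n - i) x := by
  rcases le_or_gt i n with hi | hi
  · rw [Nat.sub_add_comm hi]
    obtain ⟨c, hc, h⟩ := exists_continuous_stageCollapse_eq (n - i)
    refine ⟨fun u => projIcc 0 1 zero_le_one (c u), by fun_prop, fun x => ?_⟩
    simp only [coe_stageMap, h]
    exact projIcc_of_mem _ (stageMap (n - i) x).2
  -- For `i > n` truncated subtraction makes both stages 0, where everything is collapsed to 0.
  · rw [Nat.sub_eq_zero_of_le hi.le, Nat.sub_eq_zero_of_le hi]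
    exact ⟨id, continuous_id, fun _ => rfl⟩

/-- The relations between consecutive terms of the sequences obtained from the orbits of `toothFunction` by
collapsing the term of index `i` by `stageMap (n + 1 - i)`. -/
def stageRel (n i : ℕ) (y x : I) : Prop :=
  ∃ u v : I, (u, v) ∈ toothGraph ∧ stageMap (n + 1 - i) v = y ∧ stageMap (n - i) u = x

/-- The collapsed points of the Cantor set. -/
def stageVertices (n : ℕ) : Set I := stageMap n '' {x : I | ∃ s, cantorPoint s = x}

theorem finite_stageVertices (n : ℕ) : (stageVertices n).Finite := by
  refine Set.Finite.of_finite_image ((finite_range_stageCollapse n).subset ?_)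
    (Subtype.val_injective.injOn)
  rintro _ ⟨_, ⟨x, ⟨s, hs⟩, rfl⟩, rfl⟩
  exact ⟨s, by simp [hs]⟩

theorem eq_or_mem_stageVertices_of_stageRel {n i : ℕ} {y x : I} (h : stageRel n i y x) :
    (x : ℝ) = 5 * y ∨ x ∈ stageVertices (n - i) := by
  obtain ⟨u, v, huv, rfl, rfl⟩ := h
  rcases huv with huv | ⟨-, s, hs, -⟩
  · exact Or.inl (stageMap_sub_of_eq n i huv)
  · exact Or.inr ⟨u, ⟨s, hs⟩, rfl⟩

/-- The image of the tooth graph under monotone collapses is still toothed: the index shift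
preserves the base line, and intermediate values lift to the original segments. -/
theorem isToothed_stageRel (n : ℕ) : IsToothed (stageRel n) where
  isClosed i := by
    have hcont : Continuous fun q : I × I => (stageMap (n + 1 - i) q.2, stageMap (n - i) q.1) := by
      fun_prop
    convert (isClosed_toothGraph.isCompact.image hcont).isClosed using 1
    ext ⟨y, x⟩
    constructor
    · rintro ⟨u, v, huv, rfl, rfl⟩
      exact ⟨(u, v), huv, rfl⟩
    · rintro ⟨⟨u, v⟩, huv, h⟩
      exact ⟨u, v, huv, congrArg Prod.fst h, congrArg Prod.snd h⟩
  le_of_rel i := by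
    rintro _ _ ⟨u, v, huv, rfl, rfl⟩
    let b : I := ⟨u / 5, by have := u.2.1; positivity, by linarith [u.2.1, u.2.2]⟩
    have hb : b ≤ v := Subtype.coe_le_coe.mp (by
      have := le_of_mem_toothGraph huv
      simp only [b]
      linarith)
    rw [stageMap_sub_of_eq n i (x := u) (y := b) (by simp only [b]; ring)]
    have : (stageMap (n + 1 - i) b : ℝ) ≤ stageMap (n + 1 - i) v := stageMap_mono _ hb
    linarith
  segment i := by
    rintro _ _ ⟨u, v, huv, rfl, rfl⟩ y hy hyv
    let b : I := ⟨u / 5, by have := u.2.1; positivity, by linarith [u.2.1, u.2.2]⟩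
    have hub : (u : ℝ) = 5 * b := by simp only [b]; ring
    have hb : b ≤ v := Subtype.coe_le_coe.mp (by
      have := le_of_mem_toothGraph huv
      linarith)
    rw [stageMap_sub_of_eq n i hub] at hy
    obtain ⟨v', hv', rfl⟩ := intermediate_value_Icc hb
      (continuous_stageMap (n + 1 - i)).continuousOn
      ⟨Subtype.coe_le_coe.mp (by linarith), hyv⟩
    have hbv : (b : ℝ) ≤ v' := hv'.1
    exact ⟨u, v', toothGraph_segment huv (by linarith) hv'.2, rfl, rfl⟩
  base i := by
    rintro _ _ ⟨u, v, huv, rfl, rfl⟩ x y hxu hxy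
    obtain ⟨u', -, rfl⟩ := intermediate_value_Icc (nonneg' : (0 : I) ≤ u)
      (continuous_stageMap (n - i)).continuousOn ⟨(stageMap_zero _).le.trans nonneg', hxu⟩
    let b : I := ⟨u' / 5, by have := u'.2.1; positivity, by linarith [u'.2.1, u'.2.2]⟩
    have hub : (u' : ℝ) = 5 * b := by simp only [b]; ring
    refine ⟨u', b, Or.inl hub, Subtype.ext ?_, rfl⟩
    rw [stageMap_sub_of_eq n i hub] at hxy
    linarith
  light i y := by
    have hss : {x : I | (x : ℝ) = 5 * y}.Subsingleton := fun a ha b hb =>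
      Subtype.ext (Eq.trans ha hb.symm)
    refine Set.Finite.interior_eq_empty_of_unitInterval
      ((hss.finite.union (finite_stageVertices (n - i))).subset ?_)
    exact fun x hx => eq_or_mem_stageVertices_of_stageRel hx

theorem isToothed_toothFunction : IsToothed fun _ y x => y ∈ toothFunction x where
  isClosed _ := isClosed_toothGraph.preimage continuous_swap
  le_of_rel _ _ _ h := le_of_mem_toothGraph h
  segment _ _ _ h _ hy hyy := toothGraph_segment h hy hyy
  base _ _ _ _ _ _ _ h := Or.inl h
  light _ y := isLight_toothFunction y

/-- The inverse limit of `toothFunction`. -/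
abbrev toothLimit : Set (ℕ → I) := relSequences fun _ y x => y ∈ toothFunction x

theorem zero_mem_toothLimit : (fun _ => 0) ∈ toothLimit := fun _ => Or.inl (by simp)

theorem exists_mem_toothLimit_eq_one : ∃ z ∈ toothLimit, z 0 = 1 := by
  let p : I := ⟨1 / 2, by norm_num, by norm_num⟩
  refine ⟨fun i => if i = 0 then 1 else p, fun i => ?_, by simp⟩
  refine mem_toothFunction_of_cantorPoint (s := fun _ => 1) ?_ ?_ fun n => ?_
  · simp [cantorPoint_one, p]
  · by_cases hi : i = 0 <;> norm_num [hi, p]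
  · rw [cylinderHeight_one]
    exact le_one'

/-- The finite stages whose inverse limit is `toothLimit`. -/
abbrev stageTree (n : ℕ) : Set (ℕ → I) := relSequences (stageRel n)

/-- The projection of sequences to the stage `n`. -/
noncomputable def stageProj (n : ℕ) (z : ℕ → I) : ℕ → I := fun i => stageMap (n + 1 - i) (z i)

theorem stageProj_mem {z : ℕ → I} (hz : z ∈ toothLimit) (n : ℕ) : stageProj n z ∈ stageTree n :=
  fun i => ⟨z (i + 1), z i, hz i, rfl, by rw [stageProj, Nat.add_sub_add_right]⟩

theorem nontrivial_stageTree (n : ℕ) : (stageTree n).Nontrivial := by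
  obtain ⟨z, hz, hz0⟩ := exists_mem_toothLimit_eq_one
  refine ⟨_, stageProj_mem hz n, _, stageProj_mem zero_mem_toothLimit n, fun h => ?_⟩
  have h0 := congrArg Subtype.val (congrFun h 0)
  simp only [stageProj, hz0, stageMap_zero, Nat.sub_zero, coe_stageMap] at h0
  exact (stageCollapse_succ_pos n).ne' h0

theorem isTopologicalTree_stageTree (n : ℕ) : IsTopologicalTree (univ : Set (stageTree n)) := by
  refine (isToothed_stageRel n).isTopologicalTree (nontrivial_stageTree n) (n := n + 1) ?_
    (fun i => finite_stageVertices (n - i)) fun i y x h => eq_or_mem_stageVertices_of_stageRel h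
  intro z hz i hi
  obtain ⟨u, v, -, h, -⟩ := hz i
  rw [← h, Nat.sub_eq_zero_of_le hi, stageMap_zero_left]

/-- The projections to the stages separate points because each coordinate is collapsed at ever later
stages. They are jointly onto by compactness and closedness of the graph. -/
theorem isTreeLike_toothLimit : IsTreeLike toothLimit := by
  have hX := isToothed_toothFunction.isTruncationSystem
  refine ⟨hX.isContinuum ⟨_, zero_mem_toothLimit⟩, fun n => stageTree n, fun n => inferInstance, ?_⟩
  choose c hc hcs using fun n i => exists_continuous_stageMap_eq (n + 1) i
  have hmem : ∀ n, ∀ z ∈ stageTree (n + 1), (fun i => c n i (z i)) ∈ stageTree n := by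
    intro n z hz i
    obtain ⟨u, v, huv, hv, hu⟩ := hz i
    refine ⟨u, v, huv, ?_, ?_⟩
    · simp only [← hv, hcs]
    · have := hcs n (i + 1) u
      rw [Nat.add_sub_add_right, Nat.add_sub_add_right, hu] at this
      exact this.symm
  let g : ∀ n, stageTree (n + 1) → stageTree n := fun n z => ⟨_, hmem n z z.2⟩
  refine ⟨g, isTopologicalTree_stageTree, fun n => ?_, ?_⟩
  · refine Continuous.subtype_mk (continuous_pi fun i => (hc n i).comp ?_) _
    exact (continuous_apply i).comp continuous_subtype_val
  have hproj : ∀ z : toothLimit, (fun n => (⟨stageProj n z, stageProj_mem z.2 n⟩ : stageTree n)) ∈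
      invLimit fun i t => {g i t} := by
    intro z n
    refine Subtype.ext (funext fun i => ?_)
    exact (hcs n i (z.1 i)).symm
  let f : toothLimit → invLimit (fun i t => {g i t}) := fun z => ⟨_, hproj z⟩
  have hf : Continuous f := by
    refine Continuous.subtype_mk (continuous_pi fun n => Continuous.subtype_mk
      (continuous_pi fun i => (continuous_stageMap _).comp ?_) _) _
    exact (continuous_apply i).comp continuous_subtype_val
  have hlim : Filter.Tendsto (fun m : ℕ => (1 / 5 : ℝ) ^ m) Filter.atTop (𝓝 0) :=
    tendsto_pow_atTop_nhds_zero_of_lt_one (by norm_num) (by norm_num)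
  have hinj : Function.Injective f := by
    intro z w hzw
    refine Subtype.ext (funext fun i => Subtype.ext ?_)
    have hle : ∀ m : ℕ, |(z.1 i : ℝ) - w.1 i| ≤ (1 / 5) ^ m := by
      intro m
      have h := congrFun (congrArg Subtype.val (congrFun (congrArg Subtype.val hzw) (m + i))) i
      refine (abs_sub_le_of_stageMap_eq h).trans ?_
      exact pow_le_pow_of_le_one (by norm_num) (by norm_num) (by omega)
    have := ge_of_tendsto' hlim hle
    exact sub_eq_zero.mp (abs_nonpos_iff.mp this)
  have hsurj : Function.Surjective f := by
    rintro ⟨t, ht⟩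
    have hex : ∀ i, ∃ x : I, ∀ n, stageMap (n + 1 - i) x = (t n).1 i := by
      intro i
      -- The fibres over a compatible thread are nested, compact and nonempty.
      have hne : (⋂ n, {x : I | stageMap (n + 1 - i) x = (t n).1 i}).Nonempty := by
        refine IsCompact.nonempty_iInter_of_sequence_nonempty_isCompact_isClosed _ ?_ ?_ ?_ ?_
        · intro n x hx
          have h : t n = g n (t (n + 1)) := ht n
          have hx' : stageMap (n + 1 + 1 - i) x = (t (n + 1)).1 i := hx
          have hi : (t n).1 i = c n i ((t (n + 1)).1 i) := congrFun (congrArg Subtype.val h) i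
          change stageMap (n + 1 - i) x = (t n).1 i
          rw [hi, ← hx', hcs]
        · intro n
          obtain ⟨u, v, -, hv, -⟩ := (t n).2 i
          exact ⟨v, hv⟩
        · exact (isClosed_eq (continuous_stageMap _) continuous_const).isCompact
        · exact fun n => isClosed_eq (continuous_stageMap _) continuous_const
      obtain ⟨x, hx⟩ := hne
      exact ⟨x, fun n => mem_iInter.mp hx n⟩
    choose z hz using hex
    have hzX : z ∈ toothLimit := by
      intro i
      -- The witnesses at stage `m + i` lie on the tooth graph within `(1 / 5) ^ m` of the terms `z
      -- (i + 1)` and `z i`, so the relation passes to the limit.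
      choose u v huv hv hu using fun m => (t (m + i)).2 i
      have hlimI : ∀ (w : ℕ → I) (x : I), (∀ m, |(w m : ℝ) - x| ≤ (1 / 5) ^ m) →
          Filter.Tendsto w Filter.atTop (𝓝 x) := fun w x h =>
        tendsto_iff_dist_tendsto_zero.mpr
          (squeeze_zero (fun _ => dist_nonneg) (fun m => h m) hlim)
      have hu' : Filter.Tendsto u Filter.atTop (𝓝 (z (i + 1))) := by
        refine hlimI _ _ fun m => ?_
        have h := hz (i + 1) (m + i)
        rw [Nat.add_sub_add_right, ← hu m] at h
        refine (abs_sub_le_of_stageMap_eq h.symm).trans ?_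
        exact pow_le_pow_of_le_one (by norm_num) (by norm_num) (by omega)
      have hv' : Filter.Tendsto v Filter.atTop (𝓝 (z i)) := by
        refine hlimI _ _ fun m => ?_
        have h := hz i (m + i)
        rw [← hv m] at h
        refine (abs_sub_le_of_stageMap_eq h.symm).trans ?_
        exact pow_le_pow_of_le_one (by norm_num) (by norm_num) (by omega)
      exact isClosed_toothGraph.mem_of_tendsto (hu'.prodMk_nhds hv')
        (Filter.Eventually.of_forall huv)
    exact ⟨⟨z, hzX⟩, Subtype.ext (funext fun n => Subtype.ext (funext fun i => hz i n))⟩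
  have : CompactSpace toothLimit := isCompact_iff_compactSpace.mp hX.isCompact
  exact ⟨Continuous.homeoOfEquivCompactToT2 (f := Equiv.ofBijective f ⟨hinj, hsurj⟩) hf⟩

end StageTrees

theorem theorem1p2 :
    ∃ F : I → NonemptyCompacts I,
      UpperHemicontinuous (fun x => (F x : Set I)) ∧
      SetValuedSurjective F ∧
      IsLight F ∧
      HasIntermediateValueProperty F ∧
      (∀ n : ℕ, 0 < n → ∃ x : ℕ → I, IsOrbit F x ∧ HasPeriod x n) ∧
      interior (setValuedGraph F) = ∅ ∧
      IsContinuum (invLimit (X := fun _ => I) (fun _ x => (F x : Set I))) ∧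
      IsArcwiseConnected (invLimit (X := fun _ => I) (fun _ x => (F x : Set I))) ∧
      IsHereditarilyDecomposable (invLimit (X := fun _ => I) (fun _ x => (F x : Set I))) ∧
      IsTreeLike (invLimit (X := fun _ => I) (fun _ x => (F x : Set I))) :=
  have hX := isToothed_toothFunction.isTruncationSystem
  ⟨toothFunction, upperHemicontinuous_toothFunction, setValuedSurjective_toothFunction,
    isLight_toothFunction, hasIntermediateValueProperty_toothFunction,
    fun _ => exists_hasPeriod_toothFunction, interior_setValuedGraph_toothFunction,
    hX.isContinuum ⟨_, zero_mem_toothLimit⟩, hX.isArcwiseConnected,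
    hX.isHereditarilyDecomposable, isTreeLike_toothLimit⟩
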